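/- Let $(R,\mathfrak m,k)$ be a commutative Noetherian local ring of Krull dimension $d$. Assume that $R$ is Cohen--Macaulay (i.e. $\operatorname{depth} R=d$) and has minimal multiplicity, i.e. $e(R)=\mu(\mathfrak m)-d+1$, where $\mu(\mathfrak m)$ is the minimal number of generators of $\mathfrak m$ and $e(R)$ is $d!$ times the leading coefficient of the Hilbert--Samuel polynomial $P$ of $R$ (the polynomial with $P(n)=\operatorname{length}_R(R/\mathfrak m^{n+1})$ for all $n\gg 0$). For $n\ge 0$ let $\Omega_n^R(k)$ denote the $n$th syzygy module of $k$, i.e. the image of the $n$th differential of an augmented minimal free resolution $\cdots\to F_1\to F_0\to k\to 0$ of $k$ (so $\Omega_0^R(k)=k$). Let $M$ and $N$ be non-zero maximal Cohen--Macaulay $R$-modules (finitely generated modules of depth $d$), possibly equal, each of which is a homomorphic image of a finite direct sum of syzygy modules $\Omega_n^R(k)$, $n\ge 0$ (with varying $n$ and repetitions allowed). Then the following statements are equivalent: 1. $\operatorname{Ext}_R^i(M,N)=0$ for some $d+1$ consecutive values of $i\ge 1$; 2. $\operatorname{Ext}_R^i(M,N)=0$ for all $i\ge 1$; 3. $R$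 is regular; 4. $\operatorname{Tor}_i^R(M,N)=0$ for some $d+1$ consecutive values of $i\ge 1$; 5. $\operatorname{Tor}_i^R(M,N)=0$ for all $i\ge 1$. -/

import Mathlib

open CategoryTheory IsLocalRing
open scoped DirectSum

universe u

noncomputable section

namespace MinMult

section Ring

variable (R : Type u) [CommRing R] [IsLocalRing R]

/-- The depth of a module over a local ring: the supremum of the lengths of the `M`-regular
sequences contained in the maximal ideal. -/
def depth (M : Type u) [AddCommGroup M] [Module R M] : ℕ∞ :=
  ⨆ rs : {rs : List R // RingTheory.Sequence.IsRegular M rs ∧ ∀ r ∈ rs, r ∈ maximalIdeal R},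
    (rs.1.length : ℕ∞)

/-- A local ring is Cohen-Macaulay if its depth equals its Krull dimension. -/
def IsCohenMacaulay : Prop :=
  (depth R R : WithBot ℕ∞) = ringKrullDim R

/-- A (non-zero) module is maximal Cohen-Macaulay if it is finitely generated and its depth
equals the Krull dimension of the ring. -/
structure IsMaximalCohenMacaulay (M : Type u) [AddCommGroup M] [Module R M] : Prop where
  finite : Module.Finite R M
  depth_eq : (depth R M : WithBot ℕ∞) = ringKrullDim R

/-- The Krull dimension as a natural number (it is finite for a Noetherian local ring). -/
def dim : ℕ := ((ringKrullDim R).unbotD 0).toNat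

/-- `P` is the Hilbert-Samuel polynomial of `R`: `P(n)` is the length of `R / 𝔪 ^ (n + 1)` for all
large `n`. The length is finite when `R` is Noetherian. -/
def IsHilbertSamuelPolynomial (P : Polynomial ℚ) : Prop :=
  ∀ᶠ n : ℕ in Filter.atTop,
    ((Module.length R (R ⧸ maximalIdeal R ^ (n + 1))).toNat : ℚ) = P.eval (n : ℚ)

open Classical in
/-- The multiplicity `e(R)`: the normalized leading coefficient (that is, `d!` times the leading
coefficient, where `d` is the dimension of `R`) of the Hilbert-Samuel polynomial.
The polynomial exists for every Noetherian local ring, and it is unique. -/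
def samuelMultiplicity : ℚ :=
  if h : ∃ P, IsHilbertSamuelPolynomial R P then
    ((dim R).factorial : ℚ) * h.choose.leadingCoeff
  else 0

/-- Minimal multiplicity: `e(R) = μ(𝔪) - dim R + 1`. -/
def HasMinimalMultiplicity : Prop :=
  samuelMultiplicity R = ((maximalIdeal R).spanFinrank : ℚ) - (dim R : ℚ) + 1

/-- An augmented minimal free resolution
`⋯ ⟶ R ^ (rank 2) ⟶ R ^ (rank 1) ⟶ R ^ (rank 0) ⟶ M ⟶ 0` of a module over a local ring. -/
structure MinimalFreeResolution (M : Type u) [AddCommGroup M] [Module R M] where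
  /-- the ranks of the free modules -/
  rank : ℕ → ℕ
  /-- the differentials -/
  d : ∀ n, (Fin (rank (n + 1)) → R) →ₗ[R] (Fin (rank n) → R)
  /-- the augmentation -/
  ε : (Fin (rank 0) → R) →ₗ[R] M
  surjective_ε : Function.Surjective ε
  exact_ε : Function.Exact (d 0) ε
  exact_d : ∀ n, Function.Exact (d (n + 1)) (d n)
  minimal : ∀ n, LinearMap.range (d n) ≤ maximalIdeal R • (⊤ : Submodule R (Fin (rank n) → R))

variable {R}

/-- The `n`-th syzygy module: the image of the `n`-th differential of the augmented minimal free
resolution, the `0`-th differential being the augmentation. -/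
def MinimalFreeResolution.syzygy {M : Type u} [AddCommGroup M] [Module R M]
    (F : MinimalFreeResolution R M) : ℕ → ModuleCat.{u} R
  | 0 => ModuleCat.of R (LinearMap.range F.ε)
  | n + 1 => ModuleCat.of R (LinearMap.range (F.d n))

variable (R)

/-- `M` is a homomorphic image of a finite direct sum of syzygy modules of the residue field. -/
def IsImageOfSyzygies (M : Type u) [AddCommGroup M] [Module R M] : Prop :=
  ∃ (F : MinimalFreeResolution R (ResidueField R)) (r : ℕ) (n : Fin r → ℕ)
    (f : (⨁ i : Fin r, F.syzygy (n i)) →ₗ[R] M), Function.Surjective f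

end Ring

section ExtTor

variable (R : Type u) [CommRing R] (M N : Type u) [AddCommGroup M] [Module R M]
  [AddCommGroup N] [Module R N]

/-- `Ext_R^i(M, N) = 0`. -/
def ExtVanishes (i : ℕ) : Prop :=
  Subsingleton (Abelian.Ext (ModuleCat.of R M) (ModuleCat.of R N) i)

/-- `Tor_i^R(M, N) = 0`. -/
def TorVanishes (i : ℕ) : Prop :=
  Limits.IsZero (((Tor (ModuleCat.{u} R) i).obj (ModuleCat.of R M)).obj (ModuleCat.of R N))

end ExtTor

end MinMult

end

/-! After passing to the faithfully flat extension `S` of `R`, with `𝔪 S` the maximal ideal of `S`,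
that localizes `R[X]`, the residue field is infinite. A superficial sequence `xs` of length `d` can
then be chosen to be regular on `S`, `S ⊗ M` and `S ⊗ N` and linearly independent modulo `𝔪 ^ 2`.
The length of `S / (xs)` is `e(R)`, so minimal multiplicity says exactly that `𝔪 ^ 2 ⊆ (xs)`.
Therefore `𝔪` kills every `S ⊗ Ω_n(k)` modulo `xs`, since syzygies are generated by minimal cycles,
and so `S ⊗ M` and `S ⊗ N` are Ulrich: `𝔪 W = xs W`.

If `d + 1` consecutive `Ext`s or `Tor`s vanish, then dividing by the `d` elements of `xs` leaves the
minimal complex of one module exact at one spot with coefficients in the non-zero `k`-vector space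
`W / xs W` of the other. There all differentials vanish, so one of the ranks is zero and the module
has a finite minimal free resolution. A last step of length at least one would be an inclusion
`A ⊆ 𝔪 B` of a free module with regular quotient, whence `𝔪 A ⊆ 𝔪 ^ 2 B ∩ A ⊆ xs A` and `𝔪 = (xs)`.
Otherwise the module is free and Ulrich, which again gives `𝔪 = (xs)`, i.e. `R` is regular.
Conversely, if `𝔪 = (xs)`, then minimality forces the first syzygies of `M` and `N` to vanish. -/

noncomputable section

namespace MinMult

open RingTheory.Sequence TensorProduct

section Depth

/-- The module `M` admits a weakly regular sequence of length `n` in the maximal ideal. Unlike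
`n ≤ depth R M` this holds for every `n` if `M = 0`, so it needs no case distinction. -/
def HasDepth (R : Type*) [CommRing R] [IsLocalRing R] (n : ℕ)
    (M : Type*) [AddCommGroup M] [Module R M] : Prop :=
  ∃ rs : List R, rs.length = n ∧ (∀ r ∈ rs, r ∈ maximalIdeal R) ∧ IsWeaklyRegular M rs

/-- No non-zero element of `M` is killed by the maximal ideal: the socle of `M` is zero. -/
def SocleTrivial (R : Type*) [CommRing R] [IsLocalRing R]
    (M : Type*) [AddCommGroup M] [Module R M] : Prop :=
  ∀ u : M, (∀ a ∈ maximalIdeal R, a • u = 0) → u = 0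

variable {R : Type*} [CommRing R] [IsLocalRing R] {M : Type*} [AddCommGroup M] [Module R M]

lemma hasDepth_zero : HasDepth R 0 M :=
  ⟨[], rfl, by simp, .nil _ _⟩

lemma HasDepth.cons {n : ℕ} {x : R} (hx : x ∈ maximalIdeal R) (hxM : IsSMulRegular M x)
    (h : HasDepth R n (QuotSMulTop x M)) : HasDepth R (n + 1) M := by
  obtain ⟨rs, hl, hm, hr⟩ := h
  exact ⟨x :: rs, by simp [hl], List.forall_mem_cons.mpr ⟨hx, hm⟩, hr.cons hxM⟩

lemma HasDepth.exists_isSMulRegular {n : ℕ} (h : HasDepth R (n + 1) M) :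
    ∃ x ∈ maximalIdeal R, IsSMulRegular M x ∧ HasDepth R n (QuotSMulTop x M) := by
  obtain ⟨_ | ⟨x, rs⟩, hl, hm, hr⟩ := h
  · simp at hl
  · obtain ⟨hx, hm⟩ := List.forall_mem_cons.mp hm
    obtain ⟨hxM, hr⟩ := (isWeaklyRegular_cons_iff M x rs).mp hr
    exact ⟨x, hx, hxM, rs, by simpa using hl, hm, hr⟩

lemma HasDepth.swap [IsNoetherian R M] {n : ℕ} {x y : R}
    (h : HasDepth R n (QuotSMulTop y (QuotSMulTop x M))) (hx : x ∈ maximalIdeal R)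
    (hy : y ∈ maximalIdeal R) (hxM : IsSMulRegular M x) (hxy : IsSMulRegular (QuotSMulTop x M) y) :
    IsSMulRegular M y ∧ IsSMulRegular (QuotSMulTop y M) x ∧
      HasDepth R n (QuotSMulTop x (QuotSMulTop y M)) := by
  obtain ⟨rs, hl, hm, hr⟩ := h
  have hyx : IsWeaklyRegular M (y :: x :: rs) :=
    isWeaklyRegular_of_perm_of_subset_maximalIdeal ((hr.cons hxy).cons hxM) (.swap y x rs)
      (List.forall_mem_cons.mpr ⟨hx, List.forall_mem_cons.mpr ⟨hy, hm⟩⟩)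
  simp only [isWeaklyRegular_cons_iff] at hyx
  exact ⟨hyx.1, hyx.2.1, rs, hl, hm, hyx.2.2⟩

lemma SocleTrivial.of_isSMulRegular {x : R} (hx : x ∈ maximalIdeal R) (h : IsSMulRegular M x) :
    SocleTrivial R M :=
  fun _ hu ↦ h.right_eq_zero_of_smul (hu x hx)

lemma HasDepth.socleTrivial {n : ℕ} (h : HasDepth R (n + 1) M) : SocleTrivial R M := by
  obtain ⟨x, hx, hxM, -⟩ := h.exists_isSMulRegular
  exact .of_isSMulRegular hx hxM

lemma SocleTrivial.not_le_of_mem_associatedPrimes [IsNoetherianRing R] (h : SocleTrivial R M)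
    {p : Ideal R} (hp : p ∈ associatedPrimes R M) : ¬ maximalIdeal R ≤ p := by
  obtain ⟨hpp, u, rfl⟩ := isAssociatedPrime_iff.mp hp
  intro hle
  have hu : u = 0 := h u fun a ha ↦ by
    simpa only [Submodule.mem_colon_singleton, Submodule.mem_bot] using hle ha
  exact hpp.ne_top (by simp [hu])

lemma isSMulRegular_of_forall_notMem_associatedPrimes {R : Type*} [CommRing R] [IsNoetherianRing R]
    {M : Type*} [AddCommGroup M] [Module R M] {x : R} (h : ∀ p ∈ associatedPrimes R M, x ∉ p) :
    IsSMulRegular M x := by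
  by_contra hx
  obtain ⟨p, hp, hxp⟩ := Set.mem_iUnion₂.mp
    ((biUnion_associatedPrimes_eq_compl_regular R M).symm ▸ hx :
      x ∈ ⋃ p ∈ associatedPrimes R M, (p : Set R))
  exact h p hp hxp

lemma SocleTrivial.exists_isSMulRegular [IsNoetherianRing R] [Module.Finite R M]
    {N : Type*} [AddCommGroup N] [Module R N] [Module.Finite R N]
    (hM : SocleTrivial R M) (hN : SocleTrivial R N) :
    ∃ z ∈ maximalIdeal R, IsSMulRegular M z ∧ IsSMulRegular N z := by
  have hnot : ¬ ((maximalIdeal R : Set R) ⊆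
      ⋃ p ∈ associatedPrimes R M ∪ associatedPrimes R N, (id p : Ideal R)) := by
    rw [Ideal.subset_union_prime_finite
      ((associatedPrimes.finite R M).union (associatedPrimes.finite R N)) ⊤ ⊤]
    · rintro ⟨p, hp | hp, hle⟩
      · exact hM.not_le_of_mem_associatedPrimes hp hle
      · exact hN.not_le_of_mem_associatedPrimes hp hle
    · rintro p (hp | hp) - -
      exacts [hp.1, hp.1]
  obtain ⟨z, hz, hzp⟩ := Set.not_subset.mp hnot
  have avoid {p : Ideal R} (hp : p ∈ associatedPrimes R M ∪ associatedPrimes R N) : z ∉ p :=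
    fun hz ↦ hzp (Set.mem_biUnion hp hz)
  exact ⟨z, hz, isSMulRegular_of_forall_notMem_associatedPrimes fun p hp ↦ avoid (.inl hp),
    isSMulRegular_of_forall_notMem_associatedPrimes fun p hp ↦ avoid (.inr hp)⟩

open Pointwise in
lemma SocleTrivial.quotSMulTop {x y : R} (hxM : IsSMulRegular M x)
    (hy : y ∈ maximalIdeal R) (hyM : IsSMulRegular M y)
    (h : SocleTrivial R (QuotSMulTop y M)) : SocleTrivial R (QuotSMulTop x M) := by
  have mkQ_eq_zero (z : R) (w : M) : (z • (⊤ : Submodule R M)).mkQ w = 0 ↔ ∃ w', z • w' = w := by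
    simp [Submodule.mem_smul_pointwise_iff_exists]
  intro u hu
  -- If `u` is killed by `𝔪` modulo `x`, say `y u = x v`, then `v` is killed by `𝔪` modulo `y`.
  obtain ⟨u, rfl⟩ := Submodule.mkQ_surjective _ u
  simp_rw [← map_smul, mkQ_eq_zero] at hu
  obtain ⟨v, hv⟩ := hu y hy
  have hv0 : (y • (⊤ : Submodule R M)).mkQ v = 0 := by
    refine h _ fun a ha ↦ ?_
    rw [← map_smul, mkQ_eq_zero]
    obtain ⟨w, hw⟩ := hu a ha
    exact ⟨w, hxM <| by
      calc x • y • w = y • a • u := by rw [smul_comm, hw]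
        _ = x • a • v := by rw [smul_comm y, ← hv, smul_comm]⟩
  obtain ⟨w, rfl⟩ := (mkQ_eq_zero _ _).mp hv0
  exact (mkQ_eq_zero _ _).mpr ⟨w, hyM <| (smul_comm y x w).trans hv⟩

lemma HasDepth.quotSMulTop [IsNoetherianRing R] [Module.Finite R M] {n : ℕ}
    (h : HasDepth R (n + 1) M) {x : R} (hx : x ∈ maximalIdeal R) (hxM : IsSMulRegular M x) :
    HasDepth R n (QuotSMulTop x M) := by
  induction n generalizing M x with
  | zero => exact hasDepth_zero
  | succ n ih =>
    obtain ⟨y, hy, hyM, hMy⟩ := h.exists_isSMulRegular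
    -- Rees's exchange argument: pass from `y` to `x` through an element `z` good for both.
    obtain ⟨z, hz, hzx, hzy⟩ := SocleTrivial.exists_isSMulRegular
      (hMy.socleTrivial.quotSMulTop hxM hy hyM) hMy.socleTrivial
    obtain ⟨hzM, hyz, hMzy⟩ := (ih hMy hz hzy).swap hy hz hyM hzy
    obtain ⟨-, hxz, -⟩ := hasDepth_zero.swap hx hz hxM hzx
    obtain ⟨-, -, hMxz⟩ := (ih (hMzy.cons hy hyz) hx hxz).swap hz hx hzM hxz
    exact hMxz.cons hz hzx

end Depth

section Avoidance

variable {R : Type*} [CommRing R] [IsLocalRing R]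

lemma exists_forall_notMem_of_infinite_residueField [Infinite (ResidueField R)]
    {L : Type*} [AddCommGroup L] [Module R L] [Module.Finite R L] {s : Set (Submodule R L)}
    (hs : s.Finite) (h : ∀ V ∈ s, V ≠ ⊤) : ∃ x : L, ∀ V ∈ s, x ∉ V := by
  have : Finite s := hs
  let I := maximalIdeal R
  let _ : Field (R ⧸ I) := Ideal.Quotient.field I
  have : Infinite (R ⧸ I) := ‹Infinite (ResidueField R)›
  let q : L →ₗ[R] L ⧸ (I • ⊤ : Submodule R L) := Submodule.mkQ _
  let W (V : s) : Subspace (R ⧸ I) (L ⧸ (I • ⊤ : Submodule R L)) := .span _ (V.1.map q)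
  have hW (V : s) : (W V).restrictScalars R = V.1.map q := by
    rw [Submodule.restrictScalars_span _ _ Ideal.Quotient.mk_surjective, Submodule.span_eq]
  have hW_ne_top (V : s) : W V ≠ ⊤ := fun hV ↦ by
    have hmap : V.1.map q = ⊤ := by rw [← hW, hV, Submodule.restrictScalars_top]
    have hsup : V.1 ⊔ I • ⊤ = ⊤ := by
      simpa [q, Submodule.comap_map_eq] using congrArg (Submodule.comap q) hmap
    exact h V.1 V.2 (top_le_iff.mp (Submodule.le_of_le_smul_of_le_jacobson_bot
      Module.Finite.fg_top (maximalIdeal_le_jacobson _) hsup.ge))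
  obtain ⟨y, hy⟩ := Submodule.exists_forall_notMem_of_forall_ne_top W hW_ne_top
  obtain ⟨x, rfl⟩ := Submodule.mkQ_surjective _ y
  exact ⟨x, fun V hV hx ↦ hy ⟨V, hV⟩ (Submodule.subset_span (Submodule.mem_map_of_mem hx))⟩

end Avoidance

section Superficial

variable {R : Type*} [CommRing R] (I : Ideal R)

/-- The element `x` is superficial for `I`: `(I ^ (n + 1) : x) ⊆ I ^ n` for all large `n`. For a
non-zero-divisor `x ∈ I` this is the usual notion. -/
def IsSuperficial (x : R) : Prop :=
  ∀ᶠ n in Filter.atTop, ∀ z, x * z ∈ I ^ (n + 1) → z ∈ I ^ n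

/-- The embedding `a ↦ a t ^ n` of `I ^ n` as the degree `n` part of the Rees algebra. -/
def reesMonomial (n : ℕ) : ↥(I ^ n) →ₗ[R] reesAlgebra I :=
  (Polynomial.monomial n).restrict (q := Subalgebra.toSubmodule (reesAlgebra I))
    fun _ ha ↦ reesAlgebra.monomial_mem.mpr ha

/-- The embedding of `I` as the degree one part of the Rees algebra. -/
def reesDegreeOne : I →ₗ[R] reesAlgebra I :=
  reesMonomial I 1 ∘ₗ Submodule.inclusion (pow_one I).ge

/-- The ideal of the Rees algebra generated in degree one. -/
def reesIrrelevant : Ideal (reesAlgebra I) := Ideal.span (Set.range (reesDegreeOne I))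

variable {I}

lemma reesDegreeOne_mul_reesMonomial {n : ℕ} (a : I) (b : ↥(I ^ n))
    (hab : (a * b : R) ∈ I ^ (n + 1)) :
    reesDegreeOne I a * reesMonomial I n b = reesMonomial I (n + 1) ⟨a * b, hab⟩ :=
  Subtype.ext <| (Polynomial.monomial_mul_monomial 1 n (a : R) b).trans (by rw [add_comm]; rfl)

lemma reesMonomial_mem_irrelevant_pow {n : ℕ} (a : ↥(I ^ n)) :
    reesMonomial I n a ∈ reesIrrelevant I ^ n := by
  induction n with
  | zero => simp
  | succ n ih =>
    have hle : I * I ^ n ≤ (((reesIrrelevant I ^ (n + 1)).restrictScalars R).comap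
        (reesMonomial I (n + 1))).map (I ^ (n + 1)).subtype :=
      Submodule.mul_le.mpr fun b hb c hc ↦ by
        have hbc : b * c ∈ I ^ (n + 1) := pow_succ' I n ▸ Ideal.mul_mem_mul hb hc
        refine ⟨⟨b * c, hbc⟩, ?_, rfl⟩
        change reesMonomial I (n + 1) ⟨b * c, hbc⟩ ∈ reesIrrelevant I ^ (n + 1)
        rw [← reesDegreeOne_mul_reesMonomial ⟨b, hb⟩ ⟨c, hc⟩, pow_succ']
        exact Ideal.mul_mem_mul (Ideal.subset_span ⟨_, rfl⟩) (ih _)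
    obtain ⟨b, hb, hba⟩ := hle ((pow_succ' I n).le a.2)
    obtain rfl : b = a := Subtype.ext hba
    exact hb

lemma reesMonomial_mem_map {n : ℕ} {a : ↥(I ^ n)} (ha : (a : R) ∈ I * I ^ n) :
    reesMonomial I n a ∈ I.map (algebraMap R (reesAlgebra I)) := by
  have hle : I * I ^ n ≤ (((I.map (algebraMap R (reesAlgebra I))).restrictScalars R).comap
      (reesMonomial I n)).map (I ^ n).subtype :=
    Submodule.mul_le.mpr fun b hb c hc ↦ by
      refine ⟨b • ⟨c, hc⟩, ?_, rfl⟩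
      change reesMonomial I n (b • ⟨c, hc⟩) ∈ I.map (algebraMap R (reesAlgebra I))
      rw [map_smul, Algebra.smul_def]
      exact Ideal.mul_mem_right _ _ (Ideal.mem_map_of_mem _ hb)
  obtain ⟨b, hb, hba⟩ := hle ha
  obtain rfl : b = a := Subtype.ext hba
  exact hb

lemma coeff_mem_of_mem_map_reesAlgebra {f : reesAlgebra I}
    (hf : f ∈ I.map (algebraMap R (reesAlgebra I))) (n : ℕ) : f.1.coeff n ∈ I * I ^ n := by
  rw [Ideal.map] at hf
  induction hf using Submodule.span_induction generalizing n with
  | mem g hg =>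
    obtain ⟨a, ha, rfl⟩ := hg
    change (Polynomial.C a).coeff n ∈ _
    rw [Polynomial.coeff_C]
    split_ifs with h
    · subst h; simpa using ha
    · simp
  | zero => simp
  | add g h _ _ hg hh => simpa using add_mem (hg n) (hh n)
  | smul t g _ hg =>
    change (t.1 * g.1).coeff n ∈ _
    rw [Polynomial.coeff_mul]
    refine sum_mem fun ij hij ↦ ?_
    have := Ideal.mul_mem_mul ((mem_reesAlgebra_iff I _).mp t.2 ij.1) (hg ij.2)
    rwa [mul_left_comm, ← pow_add, Finset.HasAntidiagonal.mem_antidiagonal.mp hij] at this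

lemma exists_finite_forall_notMem_eventually_smul_eq_zero {T : Type*} [CommRing T]
    [IsNoetherianRing T] (K : Ideal T) (L : Type*) [AddCommGroup L] [Module T L]
    [Module.Finite T L] :
    ∃ s : Set (Ideal T), s.Finite ∧ (∀ P ∈ s, ¬ K ≤ P) ∧ ∀ y : T, (∀ P ∈ s, y ∉ P) →
      ∀ᶠ n in Filter.atTop, ∀ u ∈ (K ^ n • ⊤ : Submodule T L), y • u = 0 → u = 0 := by
  refine ⟨{P ∈ associatedPrimes T L | ¬ K ≤ P},
    (associatedPrimes.finite T L).subset (Set.sep_subset _ _), fun P hP ↦ hP.2, fun y hy ↦ ?_⟩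
  let A : Submodule T L := LinearMap.ker (LinearMap.lsmul T L y)
  -- The kernel `A` of `y` is supported on `V(K)`, so a power of `K` kills it.
  have hrad : K ≤ (Module.annihilator T A).radical := by
    rw [← Ideal.sInf_minimalPrimes]
    refine le_sInf fun P hP ↦ ?_
    have hPA := Module.associatedPrimes.minimalPrimes_annihilator_subset_associatedPrimes T A hP
    by_contra hle
    refine hy P ⟨associatedPrimes.subset_of_injective A.subtype_injective hPA, hle⟩ ?_
    obtain ⟨-, u, rfl⟩ := isAssociatedPrime_iff.mp hPA
    rw [Submodule.mem_colon_singleton]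
    exact Subtype.ext (LinearMap.mem_ker.mp u.2)
  obtain ⟨c, hc⟩ := Ideal.exists_pow_le_of_le_radical_of_fg hrad (IsNoetherian.noetherian _)
  obtain ⟨k, hk⟩ := K.exists_pow_inf_eq_pow_smul A
  filter_upwards [Filter.eventually_ge_atTop (k + c)] with n hn u hu hyu
  have hbot : (K ^ n • ⊤ ⊓ A : Submodule T L) ≤ ⊥ := calc
    (K ^ n • ⊤ ⊓ A : Submodule T L) = K ^ (n - k) • (K ^ k • ⊤ ⊓ A) := hk n (by omega)
    _ ≤ Module.annihilator T A • A :=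
      Submodule.smul_mono ((Ideal.pow_le_pow_right (by omega)).trans hc) inf_le_right
    _ ≤ ⊥ := Submodule.smul_le.mpr fun a ha u hu ↦
      congrArg Subtype.val (Module.mem_annihilator.mp ha ⟨u, hu⟩)
  exact (Submodule.mem_bot T).mp (hbot ⟨hu, hyu⟩)

lemma exists_finite_forall_notMem_eventually_mem {T : Type*} [CommRing T] [IsNoetherianRing T]
    (J K : Ideal T) :
    ∃ s : Set (Ideal T), s.Finite ∧ (∀ P ∈ s, ¬ K ≤ P) ∧ ∀ y : T, (∀ P ∈ s, y ∉ P) →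
      ∀ᶠ n in Filter.atTop, ∀ z ∈ K ^ n, y * z ∈ J → z ∈ J := by
  obtain ⟨s, hs, hsK, hsy⟩ := exists_finite_forall_notMem_eventually_smul_eq_zero K (T ⧸ J)
  refine ⟨s, hs, hsK, fun y hy ↦ ?_⟩
  filter_upwards [hsy y hy] with n hn z hz hyz
  have hzK : Ideal.Quotient.mk J z ∈ (K ^ n • ⊤ : Submodule T (T ⧸ J)) := by
    simpa only [Algebra.smul_def, mul_one] using!
      Submodule.smul_mem_smul hz (Submodule.mem_top (x := (1 : T ⧸ J)))
  exact Ideal.Quotient.eq_zero_iff_mem.mp (hn _ hzK (Ideal.Quotient.eq_zero_iff_mem.mpr hyz))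

variable (I)

lemma exists_finite_forall_notMem_eventually_mem_pow [IsNoetherianRing R] :
    ∃ s : Set (Submodule R I), s.Finite ∧ (∀ V ∈ s, V ≠ ⊤) ∧ ∀ x : I, (∀ V ∈ s, x ∉ V) →
      ∀ᶠ n in Filter.atTop, ∀ z ∈ I ^ n, x * z ∈ I ^ (n + 2) → z ∈ I ^ (n + 1) := by
  -- The quotient of the Rees algebra by this extended ideal is the associated graded ring of `I`.
  obtain ⟨s, hs, hsI, hsx⟩ := exists_finite_forall_notMem_eventually_mem
    (I.map (algebraMap R (reesAlgebra I))) (reesIrrelevant I)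
  refine ⟨(fun P ↦ (P.restrictScalars R).comap (reesDegreeOne I)) '' s, hs.image _, ?_, ?_⟩
  · rintro _ ⟨P, hP, rfl⟩ htop
    exact hsI P hP (Ideal.span_le.mpr (Set.range_subset_iff.mpr (Submodule.eq_top_iff'.mp htop)))
  · intro x hx
    filter_upwards [hsx (reesDegreeOne I x) fun P hP hxP ↦ hx _ ⟨P, hP, rfl⟩ hxP]
      with n hn z hz hxz
    have hmul : reesDegreeOne I x * reesMonomial I n ⟨z, hz⟩ ∈
        I.map (algebraMap R (reesAlgebra I)) := by
      rw [reesDegreeOne_mul_reesMonomial x ⟨z, hz⟩ (Ideal.pow_le_pow_right (by omega) hxz)]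
      exact reesMonomial_mem_map (by rwa [← pow_succ'])
    have hcoeff := coeff_mem_of_mem_map_reesAlgebra
      (hn _ (reesMonomial_mem_irrelevant_pow ⟨z, hz⟩) hmul) n
    rwa [← pow_succ', show (reesMonomial I n ⟨z, hz⟩).1.coeff n = z from
      Polynomial.coeff_monomial_same n z] at hcoeff

variable {I}

lemma IsSuperficial.of_isSMulRegular [IsNoetherianRing R] {x : R} (hx : IsSMulRegular R x)
    (h : ∀ᶠ n in Filter.atTop, ∀ z ∈ I ^ n, x * z ∈ I ^ (n + 2) → z ∈ I ^ (n + 1)) :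
    IsSuperficial I x := by
  obtain ⟨N, hN⟩ := Filter.eventually_atTop.mp h
  obtain ⟨k, hk⟩ := I.exists_pow_inf_eq_pow_smul (Ideal.span {x})
  filter_upwards [Filter.eventually_ge_atTop (N + k)] with n hn z hz
  -- Artin–Rees provides the start `z ∈ I ^ N`, and `h` raises the exponent one step at a time.
  have hzN : z ∈ I ^ N := by
    have hmem : x * z ∈ (I ^ (n + 1) • ⊤ ⊓ Ideal.span {x} : Ideal R) :=
      ⟨by simpa using hz, Ideal.mem_span_singleton.mpr ⟨z, rfl⟩⟩
    rw [hk _ (by omega)] at hmem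
    obtain ⟨y, hy, hyz⟩ := Ideal.mem_mul_span_singleton.mp
      (Submodule.smul_mono (Ideal.pow_le_pow_right (by omega)) inf_le_right hmem :
        x * z ∈ I ^ N * Ideal.span {x})
    rwa [← hx ((mul_comm x y).trans hyz)]
  have climb (j : ℕ) (hj : N ≤ j) : j ≤ n → z ∈ I ^ j := by
    induction j, hj using Nat.le_induction with
    | base => exact fun _ ↦ hzN
    | succ j hj ih =>
      exact fun hjn ↦ hN j hj z (ih (by omega)) (Ideal.pow_le_pow_right (by omega) hz)
  exact climb n (by omega) le_rfl

end Superficial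

section SuperficialLocal

variable {R : Type*} [CommRing R] [IsLocalRing R] [IsNoetherianRing R]

lemma SocleTrivial.not_maximalIdeal_le_sq (h : SocleTrivial R R) :
    ¬ maximalIdeal R ≤ maximalIdeal R ^ 2 := by
  intro hle
  have hbot : maximalIdeal R ≤ ⊥ :=
    Submodule.le_of_le_smul_of_le_jacobson_bot (I := maximalIdeal R) (IsNoetherian.noetherian _)
      (maximalIdeal_le_jacobson _) (by rwa [bot_sup_eq, smul_eq_mul, ← pow_two])
  exact one_ne_zero (h 1 fun a ha ↦ by simpa using hbot ha)

lemma exists_isSuperficial [Infinite (ResidueField R)]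
    {M N : Type*} [AddCommGroup M] [Module R M] [Module.Finite R M]
    [AddCommGroup N] [Module R N] [Module.Finite R N]
    (hR : SocleTrivial R R) (hM : SocleTrivial R M) (hN : SocleTrivial R N) :
    ∃ x ∈ maximalIdeal R, x ∉ maximalIdeal R ^ 2 ∧ IsSuperficial (maximalIdeal R) x ∧
      IsSMulRegular R x ∧ IsSMulRegular M x ∧ IsSMulRegular N x := by
  obtain ⟨s, hs, hs_ne_top, hsx⟩ :=
    exists_finite_forall_notMem_eventually_mem_pow (maximalIdeal R)
  let t : Set (Ideal R) := {maximalIdeal R ^ 2} ∪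
    (associatedPrimes R R ∪ (associatedPrimes R M ∪ associatedPrimes R N))
  have ht : t.Finite := (Set.finite_singleton _).union ((associatedPrimes.finite R R).union
    ((associatedPrimes.finite R M).union (associatedPrimes.finite R N)))
  have ht_not_le : ∀ p ∈ t, ¬ maximalIdeal R ≤ p := by
    rintro p (rfl | hp | hp | hp)
    exacts [hR.not_maximalIdeal_le_sq, hR.not_le_of_mem_associatedPrimes hp,
      hM.not_le_of_mem_associatedPrimes hp, hN.not_le_of_mem_associatedPrimes hp]
  obtain ⟨x, hx⟩ := exists_forall_notMem_of_infinite_residueField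
    (s := s ∪ Submodule.comap (maximalIdeal R).subtype '' t) (hs.union (ht.image _)) (by
      rintro V (hV | ⟨p, hp, rfl⟩)
      · exact hs_ne_top V hV
      · exact fun htop ↦ ht_not_le p hp (Submodule.comap_subtype_eq_top.mp htop))
  have hxt (p : Ideal R) (hp : p ∈ t) : (x : R) ∉ p := hx _ (.inr ⟨p, hp, rfl⟩)
  have hxR : IsSMulRegular R (x : R) := isSMulRegular_of_forall_notMem_associatedPrimes
    fun p hp ↦ hxt p (.inr (.inl hp))
  exact ⟨x, x.2, hxt _ (.inl rfl), .of_isSMulRegular hxR (hsx x fun V hV ↦ hx V (.inl hV)), hxR,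
    isSMulRegular_of_forall_notMem_associatedPrimes fun p hp ↦ hxt p (.inr (.inr (.inl hp))),
    isSMulRegular_of_forall_notMem_associatedPrimes fun p hp ↦ hxt p (.inr (.inr (.inr hp)))⟩

end SuperficialLocal

section Quotient

variable {R : Type*} [CommRing R] [IsLocalRing R]

lemma nontrivial_quotient_of_le_maximalIdeal {I : Ideal R} (hI : I ≤ maximalIdeal R) :
    Nontrivial (R ⧸ I) :=
  Ideal.Quotient.nontrivial_iff.mpr fun h ↦
    (maximalIdeal.isMaximal R).ne_top (top_le_iff.mp (h.ge.trans hI))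

lemma isLocalRing_quotient_of_le_maximalIdeal {I : Ideal R} (hI : I ≤ maximalIdeal R) :
    IsLocalRing (R ⧸ I) :=
  have := nontrivial_quotient_of_le_maximalIdeal hI
  .of_surjective' (Ideal.Quotient.mk I) Ideal.Quotient.mk_surjective

lemma map_mk_maximalIdeal (I : Ideal R) [IsLocalRing (R ⧸ I)] :
    (maximalIdeal R).map (Ideal.Quotient.mk I) = maximalIdeal (R ⧸ I) :=
  map_maximalIdeal_of_surjective _ Ideal.Quotient.mk_surjective

lemma mk_mem_maximalIdeal_iff {I : Ideal R} [IsLocalRing (R ⧸ I)] {r : R} :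
    Ideal.Quotient.mk I r ∈ maximalIdeal (R ⧸ I) ↔ r ∈ maximalIdeal R := by
  have := IsLocalHom.of_surjective (Ideal.Quotient.mk I) Ideal.Quotient.mk_surjective
  rw [← Ideal.mem_comap, maximalIdeal_comap]

lemma infinite_residueField_quotient [Infinite (ResidueField R)] (I : Ideal R)
    [IsLocalRing (R ⧸ I)] : Infinite (ResidueField (R ⧸ I)) :=
  have := IsLocalHom.of_surjective (Ideal.Quotient.mk I) Ideal.Quotient.mk_surjective
  .of_injective (ResidueField.map (Ideal.Quotient.mk I)) (RingHom.injective _)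

lemma HasDepth.quotient {n : ℕ} {I : Ideal R} [IsLocalRing (R ⧸ I)]
    {M : Type*} [AddCommGroup M] [Module R M] [Module (R ⧸ I) M] [IsScalarTower R (R ⧸ I) M]
    (h : HasDepth R n M) : HasDepth (R ⧸ I) n M := by
  obtain ⟨rs, hl, hm, hr⟩ := h
  refine ⟨rs.map (algebraMap R (R ⧸ I)), by simpa only [List.length_map], ?_,
    (isWeaklyRegular_map_algebraMap_iff (R ⧸ I) M rs).mpr hr⟩
  exact List.forall_mem_map.mpr fun r hr ↦ mk_mem_maximalIdeal_iff.mpr (hm r hr)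

lemma HasDepth.congr {n : ℕ} {M N : Type*} [AddCommGroup M] [Module R M] [AddCommGroup N]
    [Module R N] (e : M ≃ₗ[R] N) (h : HasDepth R n M) : HasDepth R n N := by
  obtain ⟨rs, hl, hm, hr⟩ := h
  exact ⟨rs, hl, hm, (e.isWeaklyRegular_congr rs).mp hr⟩

open Pointwise in
/-- The two ways of writing the quotient of a ring by a principal ideal. -/
def quotSMulTopSelfEquiv {R : Type*} [CommRing R] (x : R) :
    QuotSMulTop x R ≃ₗ[R] R ⧸ Ideal.span {x} :=
  Submodule.quotEquivOfEq _ _ (by simp [← Submodule.ideal_span_singleton_smul])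

end Quotient

section Length

lemma length_quotient_map_mk {R : Type*} [CommRing R] (I J : Ideal R) :
    Module.length (R ⧸ I) ((R ⧸ I) ⧸ J.map (Ideal.Quotient.mk I)) =
      Module.length R (R ⧸ J ⊔ I) := by
  rw [← Module.length_eq_of_surjective (S := R) (R := R ⧸ I) Ideal.Quotient.mk_surjective,
    sup_comm]
  exact (DoubleQuot.quotQuotEquivQuotSupₐ R I J).toLinearEquiv.length_eq

/-- The lengths along the exact sequence `0 → R/(J : x) → R/J → R/(J + (x)) → 0`. -/
lemma length_quotient_eq_add {R : Type*} [CommRing R] {I J : Ideal R} {x : R}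
    (h : ∀ z, x * z ∈ J ↔ z ∈ I) :
    Module.length R (R ⧸ J) = Module.length R (R ⧸ I) +
      Module.length R (R ⧸ J ⊔ Ideal.span {x}) := by
  have hcomap : I = Submodule.comap (LinearMap.lsmul R R x) J := by
    ext z
    exact (h z).symm
  refine Module.length_eq_add_of_exact (Submodule.mapQ I J (LinearMap.lsmul R R x) hcomap.le)
    (Submodule.factor le_sup_left) ?_ (Submodule.factor_surjective _) (LinearMap.exact_iff.mpr ?_)
  · rw [← LinearMap.ker_eq_bot, Submodule.ker_mapQ, ← hcomap, Submodule.mkQ_map_self]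
  · rw [Submodule.range_mapQ, Submodule.factor, Submodule.ker_mapQ, Submodule.comap_id,
      Submodule.map_sup, Submodule.mkQ_map_self, bot_sup_eq]
    congr 1
    ext z
    simp [Ideal.mem_span_singleton', mul_comm]

variable {R : Type*} [CommRing R] [IsLocalRing R]

lemma length_quotient_maximalIdeal : Module.length R (R ⧸ maximalIdeal R) = 1 :=
  Module.length_eq_one_iff.mpr
    (isSimpleModule_iff_quot_maximal.mpr ⟨_, maximalIdeal.isMaximal R, ⟨.refl _ _⟩⟩)

lemma length_ne_top_of_pow_le [IsNoetherianRing R] {J : Ideal R} {n : ℕ}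
    (h : maximalIdeal R ^ n ≤ J) : Module.length R (R ⧸ J) ≠ ⊤ := by
  rw [Module.length_eq_of_surjective (S := R) (R := R ⧸ J) Ideal.Quotient.mk_surjective]
  rcases subsingleton_or_nontrivial (R ⧸ J) with hJ | hJ
  · simp
  have : IsLocalRing (R ⧸ J) :=
    .of_surjective' (Ideal.Quotient.mk J) Ideal.Quotient.mk_surjective
  have : IsArtinianRing (R ⧸ J) := by
    rw [isArtinianRing_iff_isNilpotent_maximalIdeal]
    refine ⟨n, ?_⟩
    rw [← map_mk_maximalIdeal, ← Ideal.map_pow, Ideal.zero_eq_bot, Ideal.map_eq_bot_iff_le_ker,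
      Ideal.mk_ker]
    exact h
  exact Module.length_ne_top

variable {S : Type*} [CommRing S] [IsLocalRing S] [Algebra R S] [Module.Flat R S]

lemma length_quotient_maximalIdeal_pow
    (hm : (maximalIdeal R).map (algebraMap R S) = maximalIdeal S) (n : ℕ) :
    Module.length S (S ⧸ maximalIdeal S ^ n) = Module.length R (R ⧸ maximalIdeal R ^ n) := by
  have : IsLocalHom (algebraMap R S) := ((local_hom_TFAE _).out 2 0).mp hm.le
  have h := IsLocalRing.length_baseChange R S (R ⧸ maximalIdeal R ^ n)
  rwa [hm, length_quotient_maximalIdeal, mul_one,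
    ← (Algebra.TensorProduct.quotIdealMapEquivTensorQuot S
      (maximalIdeal R ^ n)).toLinearEquiv.length_eq, Ideal.map_pow, hm] at h

end Length

section HilbertSamuel

open Filter fwdDiff

lemma fwdDiff_iter_congr {f g : ℕ → ℚ} (h : f =ᶠ[atTop] g) (d : ℕ) :
    (Δ_[1])^[d] f =ᶠ[atTop] (Δ_[1])^[d] g := by
  induction d with
  | zero => exact h
  | succ d ih =>
    rw [Function.iterate_succ', Function.comp_apply, Function.comp_apply]
    filter_upwards [ih, (tendsto_add_atTop_nat 1).eventually ih] with n hn hn'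
    rw [fwdDiff, fwdDiff, hn, hn']

lemma fwdDiff_iter_eval_natCast (P : Polynomial ℚ) (d : ℕ) :
    (Δ_[1])^[d] (fun n : ℕ ↦ P.eval (n : ℚ)) = fun n : ℕ ↦ (Δ_[1])^[d] P.eval (n : ℚ) := by
  ext n
  simp [fwdDiff_iter_eq_sum_shift]

lemma factorial_mul_leadingCoeff_eq {P : Polynomial ℚ} {d : ℕ} {c : ℚ} (hc : c ≠ 0)
    (h : (Δ_[1])^[d] (fun n : ℕ ↦ P.eval (n : ℚ)) =ᶠ[atTop] fun _ ↦ c) :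
    d.factorial * P.leadingCoeff = c := by
  obtain ⟨n, hn⟩ := h.exists
  rw [fwdDiff_iter_eval_natCast] at hn
  rcases lt_trichotomy P.natDegree d with hlt | rfl | hgt
  · rw [P.fwdDiff_iter_eq_zero_of_degree_lt hlt] at hn
    exact absurd hn.symm hc
  · simpa [P.fwdDiff_iter_degree_eq_factorial, mul_comm] using hn
  · obtain ⟨k, hk⟩ := Nat.exists_eq_add_of_lt hgt
    obtain ⟨m, hm⟩ := (fwdDiff_iter_congr h (k + 1)).exists
    rw [← Function.iterate_add_apply, show k + 1 + d = P.natDegree by omega,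
      fwdDiff_iter_eval_natCast, P.fwdDiff_iter_degree_eq_factorial,
      Function.iterate_succ_apply, fwdDiff_const] at hm
    have hP : P = 0 := by
      simpa [fwdDiff_iter_eq_sum_shift, Nat.factorial_ne_zero] using hm
    simp [hP] at hgt

/-- The Hilbert–Samuel function of `R`, with the truncation of infinite lengths to zero that is
also used in `IsHilbertSamuelPolynomial`. -/
def hilbertSamuel (R : Type*) [CommRing R] [IsLocalRing R] (n : ℕ) : ℚ :=
  (Module.length R (R ⧸ maximalIdeal R ^ (n + 1))).toNat

variable {R : Type*} [CommRing R] [IsLocalRing R]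

lemma fwdDiff_hilbertSamuel [IsNoetherianRing R] {x : R} (hx : x ∈ maximalIdeal R)
    (hxs : IsSuperficial (maximalIdeal R) x) [IsLocalRing (R ⧸ Ideal.span {x})] :
    Δ_[1] (hilbertSamuel R) =ᶠ[atTop] fun n ↦ hilbertSamuel (R ⧸ Ideal.span {x}) (n + 1) := by
  filter_upwards [(tendsto_add_atTop_nat 1).eventually hxs] with n hn
  have hadd := length_quotient_eq_add fun z ↦
    ⟨hn z, fun hz ↦ pow_succ' (maximalIdeal R) (n + 1) ▸ Ideal.mul_mem_mul hx hz⟩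
  rw [fwdDiff, hilbertSamuel, hilbertSamuel, hilbertSamuel, hadd,
    ENat.toNat_add (length_ne_top_of_pow_le le_rfl) (length_ne_top_of_pow_le le_sup_left),
    ← length_quotient_map_mk, Ideal.map_pow, map_mk_maximalIdeal]
  push_cast
  ring

lemma hilbertSamuel_eventuallyEq_of_isArtinianRing [IsArtinianRing R] :
    hilbertSamuel R =ᶠ[atTop] fun _ ↦ ((Module.length R R).toNat : ℚ) := by
  obtain ⟨k, hk⟩ := (isArtinianRing_iff_isNilpotent_maximalIdeal R).mp ‹_›
  filter_upwards [eventually_ge_atTop k] with n hn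
  have hpow : maximalIdeal R ^ (n + 1) = ⊥ := by
    rw [← Ideal.zero_eq_bot, pow_eq_zero_of_le (by omega) hk]
  rw [hilbertSamuel, hpow, (Submodule.quotEquivOfEqBot _ rfl).length_eq]

/-- Each member of the sequence lies outside the ideal generated by its predecessors and the
square of the maximal ideal. For a sequence in the maximal ideal this says that its classes in the
cotangent space are linearly independent. -/
def IsIndependentModSq (xs : List R) : Prop :=
  ∀ (i : ℕ) (h : i < xs.length), xs[i] ∉ Ideal.ofList (xs.take i) ⊔ maximalIdeal R ^ 2

lemma IsIndependentModSq.cons {x : R} [IsLocalRing (R ⧸ Ideal.span {x})]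
    (hx : x ∉ maximalIdeal R ^ 2) {xs : List R}
    (h : IsIndependentModSq (xs.map (Ideal.Quotient.mk (Ideal.span {x})))) :
    IsIndependentModSq (x :: xs) := by
  rintro (_ | i) hi
  · simpa using hx
  · intro hmem
    refine h i (by simpa using hi) ?_
    have hmap := Ideal.mem_map_of_mem (Ideal.Quotient.mk (Ideal.span {x})) hmem
    rw [Ideal.map_sup, Ideal.map_pow, map_mk_maximalIdeal, List.take_succ_cons,
      Ideal.ofList_cons, Ideal.map_sup, Ideal.map_quotient_self, bot_sup_eq,
      Ideal.map_ofList, List.map_take] at hmap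
    simpa only [List.getElem_map, List.getElem_cons_succ] using hmap

lemma ringKrullDim_quotient_span_singleton [IsNoetherianRing R] {x : R} {d : ℕ}
    (hx : x ∈ maximalIdeal R) (hxR : IsSMulRegular R x) (hd : ringKrullDim R = (d + 1 : ℕ)) :
    ringKrullDim (R ⧸ Ideal.span {x}) = d := by
  have h := ringKrullDim_quotient_span_singleton_succ_eq_ringKrullDim hxR hx
  rw [hd, Nat.cast_succ] at h
  exact ENat.WithBot.add_one_cancel.mp h

theorem exists_isWeaklyRegular_length_eq_multiplicity [IsNoetherianRing R]
    [Infinite (ResidueField R)] {M N : Type*} [AddCommGroup M] [Module R M] [Module.Finite R M]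
    [AddCommGroup N] [Module R N] [Module.Finite R N] {d : ℕ} (hd : ringKrullDim R = d)
    (hR : HasDepth R d R) (hM : HasDepth R d M) (hN : HasDepth R d N) :
    ∃ xs : List R, xs.length = d ∧ (∀ r ∈ xs, r ∈ maximalIdeal R) ∧ IsWeaklyRegular R xs ∧
      IsWeaklyRegular M xs ∧ IsWeaklyRegular N xs ∧ IsIndependentModSq xs ∧
      ∃ e : ℕ, Module.length R (R ⧸ Ideal.ofList xs) = e ∧
        (Δ_[1])^[d] (hilbertSamuel R) =ᶠ[atTop] fun _ ↦ (e : ℚ) := by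
  induction d generalizing R M N with
  | zero =>
    have : IsArtinianRing R := by
      rw [isArtinianRing_iff_krullDimLE_zero, Ring.KrullDimLE, Order.krullDimLE_iff,
        ← ringKrullDim, hd]
    refine ⟨[], rfl, by simp, .nil _ _, .nil _ _, .nil _ _, by simp [IsIndependentModSq], _, ?_,
      hilbertSamuel_eventuallyEq_of_isArtinianRing⟩
    rw [Ideal.ofList_nil, (Submodule.quotEquivOfEqBot _ rfl).length_eq,
      ENat.natCast_toNat Module.length_ne_top]
  | succ d ih =>
    obtain ⟨x, hx, hx2, hxs, hxR, hxM, hxN⟩ :=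
      exists_isSuperficial hR.socleTrivial hM.socleTrivial hN.socleTrivial
    let I := Ideal.span {x}
    have : IsLocalRing (R ⧸ I) :=
      isLocalRing_quotient_of_le_maximalIdeal ((Ideal.span_singleton_le_iff_mem _).mpr hx)
    have := infinite_residueField_quotient I
    have : Module.Finite (R ⧸ I) (QuotSMulTop x M) := .of_restrictScalars_finite R _ _
    have : Module.Finite (R ⧸ I) (QuotSMulTop x N) := .of_restrictScalars_finite R _ _
    obtain ⟨ys, hyl, hym, hyR, hyM, hyN, hyi, e, he, hye⟩ := ih (R := R ⧸ I)
      (M := QuotSMulTop x M) (N := QuotSMulTop x N)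
      (ringKrullDim_quotient_span_singleton hx hxR hd)
      ((hR.quotSMulTop hx hxR).congr (quotSMulTopSelfEquiv x)).quotient
      (hM.quotSMulTop hx hxM).quotient (hN.quotSMulTop hx hxN).quotient
    obtain ⟨xs, rfl⟩ := List.map_surjective_iff.mpr Ideal.Quotient.mk_surjective ys
    refine ⟨x :: xs, by simpa using hyl, List.forall_mem_cons.mpr ⟨hx, fun r hr ↦
        mk_mem_maximalIdeal_iff.mp (hym _ (List.mem_map_of_mem hr))⟩, .cons hxR ?_,
      hyM.cons' hxM, hyN.cons' hxN, hyi.cons hx2, e, ?_, ?_⟩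
    · exact ((quotSMulTopSelfEquiv x).isWeaklyRegular_congr xs).mpr
        ((isWeaklyRegular_map_algebraMap_iff (R ⧸ I) _ xs).mp hyR)
    · rw [← he, ← Ideal.map_ofList, length_quotient_map_mk, Ideal.ofList_cons, sup_comm]
    · filter_upwards [fwdDiff_iter_congr (fwdDiff_hilbertSamuel hx hxs) d,
        (tendsto_add_atTop_nat 1).eventually hye] with n hn hne
      rw [Function.iterate_succ_apply, hn, fwdDiff_iter_comp_add, hne]

end HilbertSamuel

section EmbeddingDimension

lemma eq_of_le_of_length_quotient_le {R : Type*} [CommRing R] {I J : Ideal R} (hIJ : I ≤ J)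
    (h : Module.length R (R ⧸ I) ≤ Module.length R (R ⧸ J))
    (hJ : Module.length R (R ⧸ J) ≠ ⊤) : I = J := by
  let f : (R ⧸ I) →ₗ[R] (R ⧸ J) := Submodule.factor hIJ
  have hadd := Module.length_eq_add_of_exact (LinearMap.ker f).subtype f
    (Submodule.subtype_injective _) (Submodule.factor_surjective hIJ)
    (LinearMap.exact_subtype_ker_map f)
  have hker : LinearMap.ker f = ⊥ := by
    rw [← Submodule.subsingleton_iff_eq_bot, ← Module.length_eq_zero_iff (R := R)]
    rw [hadd, ← zero_add (Module.length R (R ⧸ J)), ← add_assoc, add_zero] at h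
    exact le_zero_iff.mp ((ENat.add_le_add_iff_right hJ).mp h)
  refine le_antisymm hIJ fun a ha ↦ (Submodule.Quotient.mk_eq_zero I).mp ?_
  exact LinearMap.ker_eq_bot'.mp hker _ ((Submodule.Quotient.mk_eq_zero J).mpr ha)

variable {R : Type*} [CommRing R] [IsLocalRing R]

lemma length_quotient_maximalIdeal_sq [IsNoetherianRing R] :
    Module.length R (R ⧸ maximalIdeal R ^ 2) = (maximalIdeal R).spanFinrank + 1 := by
  have hcot : Module.length R (CotangentSpace R) = (maximalIdeal R).spanFinrank := by
    rw [spanFinrank_maximalIdeal_eq_finrank_cotangentSpace,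
      Module.length_eq_of_surjective (S := R) (R := ResidueField R) Ideal.Quotient.mk_surjective,
      Module.length_of_free_of_finite, Module.length_eq_one, mul_one]
  have hle : maximalIdeal R ^ 2 ≤ maximalIdeal R := Ideal.pow_le_self two_ne_zero
  rw [← hcot, ← length_quotient_maximalIdeal (R := R)]
  refine Module.length_eq_add_of_exact (maximalIdeal R).cotangentToQuotientSquare
    (Submodule.factor hle) (Ideal.cotangentToQuotientSquare_injective _)
    (Submodule.factor_surjective hle) (LinearMap.exact_iff.mpr ?_)
  rw [Ideal.range_cotangentToQuotientSquare, Submodule.factor, Submodule.ker_mapQ,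
    Submodule.comap_id]
  ext z
  simp [Ideal.cotangentIdeal]

lemma length_quotient_le_add_length {x : R} (hx : x ∈ maximalIdeal R) {J : Ideal R}
    (hJ : maximalIdeal R ^ 2 ≤ J) :
    Module.length R (R ⧸ J) ≤ Module.length R (R ⧸ J ⊔ Ideal.span {x}) + 1 := by
  have hcolon : maximalIdeal R ≤ J.colon {x} := fun a ha ↦ by
    rw [Submodule.mem_colon_singleton, smul_eq_mul]
    exact hJ (pow_two (maximalIdeal R) ▸ Ideal.mul_mem_mul ha hx)
  have hle : Module.length R (R ⧸ J.colon {x}) ≤ 1 :=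
    length_quotient_maximalIdeal (R := R) ▸ Module.length_le_of_surjective
      (Submodule.factor hcolon) (Submodule.factor_surjective hcolon)
  rw [length_quotient_eq_add (I := J.colon {x}) fun z ↦ by
    rw [Submodule.mem_colon_singleton, smul_eq_mul, mul_comm], add_comm]
  gcongr

lemma length_quotient_sq_le {xs : List R} (h : ∀ r ∈ xs, r ∈ maximalIdeal R) :
    Module.length R (R ⧸ maximalIdeal R ^ 2) ≤
      Module.length R (R ⧸ Ideal.ofList xs ⊔ maximalIdeal R ^ 2) + xs.length := by
  induction xs with
  | nil => rw [Ideal.ofList_nil, bot_sup_eq, List.length_nil, Nat.cast_zero, add_zero]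
  | cons x xs ih =>
    obtain ⟨hx, hxs⟩ := List.forall_mem_cons.mp h
    have hstep := length_quotient_le_add_length hx
      (le_sup_right : _ ≤ Ideal.ofList xs ⊔ maximalIdeal R ^ 2)
    rw [sup_comm (Ideal.ofList xs ⊔ _), ← sup_assoc, ← Ideal.ofList_cons] at hstep
    grw [ih hxs, hstep]
    rw [List.length_cons, Nat.cast_succ, add_assoc, add_comm 1]

lemma ofList_le_maximalIdeal {xs : List R} (h : ∀ r ∈ xs, r ∈ maximalIdeal R) :
    Ideal.ofList xs ≤ maximalIdeal R :=
  Ideal.span_le.mpr h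

/-- A regular sequence generating a minimal reduction of the maximal ideal of the smallest possible
colength `μ(𝔪) - d + 1`, where `d` is the length of the sequence. The reduction number is then at
most one, see `IsMinimalReduction.sq_le`. -/
structure IsMinimalReduction (xs : List R) : Prop where
  mem_maximalIdeal : ∀ r ∈ xs, r ∈ maximalIdeal R
  isWeaklyRegular : IsWeaklyRegular R xs
  isIndependentModSq : IsIndependentModSq xs
  length_add_length :
    Module.length R (R ⧸ Ideal.ofList xs) + xs.length = (maximalIdeal R).spanFinrank + 1

namespace IsMinimalReduction

variable [IsNoetherianRing R] {xs : List R} (hxs : IsMinimalReduction xs)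

include hxs

lemma sq_le : maximalIdeal R ^ 2 ≤ Ideal.ofList xs := by
  have hle : Module.length R (R ⧸ Ideal.ofList xs) ≤
      Module.length R (R ⧸ Ideal.ofList xs ⊔ maximalIdeal R ^ 2) := by
    have h := length_quotient_sq_le hxs.mem_maximalIdeal
    rw [length_quotient_maximalIdeal_sq, ← hxs.length_add_length] at h
    exact (ENat.add_le_add_iff_right (ENat.natCast_ne_top _)).mp h
  rw [eq_of_le_of_length_quotient_le le_sup_left hle (length_ne_top_of_pow_le le_sup_right)]
  exact le_sup_right

lemma isRegularLocalRing_iff (hd : ringKrullDim R = xs.length) :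
    IsRegularLocalRing R ↔ maximalIdeal R ≤ Ideal.ofList xs := by
  have hlen := hxs.length_add_length
  refine ⟨fun hreg ↦ ?_, fun hle ↦ IsRegularLocalRing.of_spanFinrank_maximalIdeal_le R ?_⟩
  · have hrank : (maximalIdeal R).spanFinrank = xs.length := by
      have h := (_root_.isRegularLocalRing_iff R).mp hreg
      rw [hd] at h
      exact_mod_cast h
    rw [hrank, add_comm _ 1] at hlen
    have hone : Module.length R (R ⧸ Ideal.ofList xs) = 1 :=
      ENat.add_left_injective_of_ne_top (ENat.natCast_ne_top _) hlen
    refine (eq_of_le_of_length_quotient_le (ofList_le_maximalIdeal hxs.mem_maximalIdeal)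
      ?_ ?_).ge <;> simp [hone, length_quotient_maximalIdeal]
  · rw [(ofList_le_maximalIdeal hxs.mem_maximalIdeal).antisymm hle, length_quotient_maximalIdeal,
      add_comm] at hlen
    rw [hd]
    exact_mod_cast (ENat.add_left_injective_of_ne_top ENat.one_ne_top hlen).ge

end IsMinimalReduction

end EmbeddingDimension

section MinimalMultiplicity

open Filter fwdDiff

lemma dim_eq {R : Type u} [CommRing R] [IsLocalRing R] {d : ℕ} (hd : ringKrullDim R = d) :
    dim R = d := by
  rw [dim, hd]
  rfl

lemma hasDepth_of_depth_eq {R : Type u} [CommRing R] [IsLocalRing R]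
    {M : Type u} [AddCommGroup M] [Module R M] [Nontrivial M] {d : ℕ} (h : depth R M = d) :
    HasDepth R d M := by
  have : Nonempty {rs : List R // IsRegular M rs ∧ ∀ r ∈ rs, r ∈ maximalIdeal R} :=
    ⟨⟨[], .nil _ _, by simp⟩⟩
  obtain ⟨⟨rs, hreg, hmem⟩, hrs⟩ :=
    ENat.exists_eq_iSup_of_lt_top (h.trans_lt (ENat.natCast_lt_top d))
  exact ⟨rs, ENat.natCast_inj.mp (hrs.trans h), hmem, hreg.toIsWeaklyRegular⟩

variable {R : Type u} [CommRing R] [IsLocalRing R] [IsNoetherianRing R] {d : ℕ}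

lemma HasMinimalMultiplicity.exists_isHilbertSamuelPolynomial (h : HasMinimalMultiplicity R)
    (hd : ringKrullDim R = d) :
    ∃ P, IsHilbertSamuelPolynomial R P ∧
      (d.factorial : ℚ) * P.leadingCoeff = (maximalIdeal R).spanFinrank - d + 1 := by
  have hle : (d : ℚ) ≤ (maximalIdeal R).spanFinrank := by
    have h := ringKrullDim_le_spanFinrank_maximalIdeal (R := R)
    rw [hd] at h
    exact_mod_cast h
  rw [HasMinimalMultiplicity, samuelMultiplicity, dim_eq hd] at h
  split_ifs at h with hex
  · exact ⟨_, hex.choose_spec, h⟩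
  · linarith

lemma HasMinimalMultiplicity.add_eq_spanFinrank_add_one (h : HasMinimalMultiplicity R)
    (hd : ringKrullDim R = d) {e : ℕ} (he : e ≠ 0)
    (heq : (Δ_[1])^[d] (hilbertSamuel R) =ᶠ[atTop] fun _ ↦ (e : ℚ)) :
    e + d = (maximalIdeal R).spanFinrank + 1 := by
  obtain ⟨P, hP, hlead⟩ := h.exists_isHilbertSamuelPolynomial hd
  have hPe : (Δ_[1])^[d] (fun n : ℕ ↦ P.eval (n : ℚ)) =ᶠ[atTop] fun _ ↦ (e : ℚ) :=
    (fwdDiff_iter_congr (EventuallyEq.symm hP) d).trans heq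
  rw [factorial_mul_leadingCoeff_eq (Nat.cast_ne_zero.mpr he) hPe] at hlead
  have : (e : ℚ) + d = (maximalIdeal R).spanFinrank + 1 := by linarith
  exact_mod_cast this

theorem HasMinimalMultiplicity.exists_isMinimalReduction [Infinite (ResidueField R)]
    (h : HasMinimalMultiplicity R) (hd : ringKrullDim R = d) {M N : Type*}
    [AddCommGroup M] [Module R M] [Module.Finite R M]
    [AddCommGroup N] [Module R N] [Module.Finite R N]
    (hR : HasDepth R d R) (hM : HasDepth R d M) (hN : HasDepth R d N) :
    ∃ xs : List R, xs.length = d ∧ IsMinimalReduction xs ∧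
      IsWeaklyRegular M xs ∧ IsWeaklyRegular N xs := by
  obtain ⟨xs, hlen, hmem, hxR, hxM, hxN, hind, e, he, heq⟩ :=
    exists_isWeaklyRegular_length_eq_multiplicity hd hR hM hN
  have := nontrivial_quotient_of_le_maximalIdeal (ofList_le_maximalIdeal hmem)
  have he0 : e ≠ 0 := by
    rintro rfl
    exact Module.length_pos.ne' he
  refine ⟨xs, hlen, ⟨hmem, hxR, hind, ?_⟩, hxM, hxN⟩
  rw [he, hlen]
  exact_mod_cast h.add_eq_spanFinrank_add_one hd he0 heq

end MinimalMultiplicity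

section GenericExtension

section Flat

variable {R S : Type*} [CommRing R] [IsLocalRing R] [CommRing S] [IsLocalRing S] [Algebra R S]
  [Module.Flat R S]

lemma HasDepth.tensorProduct [IsLocalHom (algebraMap R S)] {n : ℕ} {M : Type*} [AddCommGroup M]
    [Module R M] (h : HasDepth R n M) : HasDepth S n (S ⊗[R] M) := by
  obtain ⟨rs, hlen, hmem, hreg⟩ := h
  refine ⟨rs.map (algebraMap R S), by simpa only [List.length_map],
    List.forall_mem_map.mpr fun r hr ↦ ?_,
    hreg.of_flat_of_isBaseChange (TensorProduct.isBaseChange R M S)⟩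
  exact map_maximalIdeal_le (algebraMap R S) (Ideal.mem_map_of_mem _ (hmem r hr))

variable [IsNoetherianRing R] [IsNoetherianRing S]
  (hm : (maximalIdeal R).map (algebraMap R S) = maximalIdeal S)

include hm

lemma spanFinrank_maximalIdeal_eq :
    (maximalIdeal S).spanFinrank = (maximalIdeal R).spanFinrank := by
  have h := length_quotient_maximalIdeal_pow hm 2
  rw [length_quotient_maximalIdeal_sq, length_quotient_maximalIdeal_sq] at h
  exact_mod_cast ENat.add_left_injective_of_ne_top ENat.one_ne_top h

lemma isRegularLocalRing_iff_of_flat (hdim : ringKrullDim S = ringKrullDim R) :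
    IsRegularLocalRing S ↔ IsRegularLocalRing R := by
  rw [isRegularLocalRing_iff, isRegularLocalRing_iff, spanFinrank_maximalIdeal_eq hm, hdim]

end Flat

lemma HasMinimalMultiplicity.of_flat {R S : Type u} [CommRing R] [IsLocalRing R] [CommRing S]
    [IsLocalRing S] [Algebra R S] [Module.Flat R S] [IsNoetherianRing R] [IsNoetherianRing S]
    (h : HasMinimalMultiplicity R) (hm : (maximalIdeal R).map (algebraMap R S) = maximalIdeal S)
    (hdim : ringKrullDim S = ringKrullDim R) : HasMinimalMultiplicity S := by
  have hpoly : IsHilbertSamuelPolynomial S = IsHilbertSamuelPolynomial R := by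
    funext P
    simp only [IsHilbertSamuelPolynomial, length_quotient_maximalIdeal_pow hm]
  rw [HasMinimalMultiplicity, samuelMultiplicity, hpoly, dim, hdim,
    spanFinrank_maximalIdeal_eq hm]
  exact h

variable (R : Type u) [CommRing R] [IsLocalRing R]

open Polynomial

/-- The local ring `R(X)`, the localization of `R[X]` at the extension of the maximal ideal. It is
flat over `R`, its maximal ideal is extended from `R`, and its residue field is infinite. -/
abbrev GenericExtension : Type u :=
  Localization.AtPrime ((maximalIdeal R).map (C : R →+* R[X]))

lemma map_maximalIdeal_genericExtension :
    (maximalIdeal R).map (algebraMap R (GenericExtension R)) =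
      maximalIdeal (GenericExtension R) := by
  rw [IsScalarTower.algebraMap_eq R R[X] (GenericExtension R), ← Ideal.map_map,
    Polynomial.algebraMap_eq, Localization.AtPrime.map_eq_maximalIdeal]

lemma ringKrullDim_genericExtension [IsNoetherianRing R] :
    ringKrullDim (GenericExtension R) = ringKrullDim R := by
  rw [IsLocalization.AtPrime.ringKrullDim_eq_height ((maximalIdeal R).map (C : R →+* R[X])),
    height_map_C, maximalIdeal_height_eq_ringKrullDim]

instance : Module.Flat R (GenericExtension R) :=
  .trans R R[X] _

instance : IsLocalHom (algebraMap R (GenericExtension R)) :=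
  ((local_hom_TFAE _).out 2 0).mp (map_maximalIdeal_genericExtension R).le

instance : Module.FaithfullyFlat R (GenericExtension R) :=
  .of_flat_of_isLocalHom

instance : Infinite (ResidueField (GenericExtension R)) := by
  refine .of_injective (fun n : ℕ ↦
    residue (GenericExtension R) (algebraMap R[X] (GenericExtension R) (X ^ n))) fun i j hij ↦ ?_
  by_contra hne
  rw [← sub_eq_zero, ← map_sub, ← map_sub, residue_eq_zero_iff,
    IsLocalization.AtPrime.to_map_mem_maximal_iff (GenericExtension R)
      ((maximalIdeal R).map (C : R →+* R[X])), Ideal.mem_map_C_iff] at hij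
  simpa [coeff_X_pow, hne] using hij i

end GenericExtension

section FreeModules

variable {R : Type*} [CommRing R] {G H : Type*} [AddCommGroup G] [Module R G] [AddCommGroup H]
  [Module R H]

lemma mem_ideal_smul_top_iff_repr {ι : Type*} (b : Module.Basis ι R G) (I : Ideal R) (g : G) :
    g ∈ (I • ⊤ : Submodule R G) ↔ ∀ i, b.repr g i ∈ I := by
  refine ⟨fun hg i ↦ ?_, fun h ↦ ?_⟩
  · induction hg using Submodule.smul_induction_on' with
    | smul r hr n _ => simpa using I.mul_mem_right _ hr
    | add x _ y _ hx hy => simpa using add_mem hx hy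
  · rw [← b.linearCombination_repr g, Finsupp.linearCombination_apply]
    exact sum_mem fun i _ ↦ Submodule.smul_mem_smul (h i) Submodule.mem_top

lemma mem_ideal_smul_top_of_smul_mem [Module.Free R G] {I J : Ideal R} {x : R}
    (h : ∀ s, x * s ∈ I → s ∈ J) {g : G} (hg : x • g ∈ (I • ⊤ : Submodule R G)) :
    g ∈ (J • ⊤ : Submodule R G) := by
  let b := Module.Free.chooseBasis R G
  rw [mem_ideal_smul_top_iff_repr b] at hg ⊢
  exact fun i ↦ h _ (by simpa using hg i)

lemma le_of_smul_top_le [Module.Free R G] [Nontrivial G] {I J : Ideal R}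
    (h : I • (⊤ : Submodule R G) ≤ J • ⊤) : I ≤ J := by
  have := Module.nontrivial R G
  let b := Module.Free.chooseBasis R G
  obtain ⟨i⟩ := b.index_nonempty
  intro r hr
  simpa using (mem_ideal_smul_top_iff_repr b J _).mp
    (h (Submodule.smul_mem_smul hr (Submodule.mem_top (x := b i)))) i

lemma map_mem_ideal_smul_top (f : G →ₗ[R] H) {I : Ideal R} {g : G}
    (hg : g ∈ (I • ⊤ : Submodule R G)) : f g ∈ (I • ⊤ : Submodule R H) :=
  Submodule.smul_top_le_comap_smul_top I f hg

lemma map_mem_ideal_sq_smul_top {f : G →ₗ[R] H} {I : Ideal R}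
    (hf : LinearMap.range f ≤ I • ⊤) {g : G} (hg : g ∈ (I • ⊤ : Submodule R G)) :
    f g ∈ (I ^ 2 • ⊤ : Submodule R H) := by
  have hmap := Submodule.mem_map_of_mem (f := f) hg
  rw [Submodule.map_smul'', Submodule.map_top] at hmap
  rw [pow_two, Submodule.mul_smul]
  exact Submodule.smul_mono le_rfl hf hmap

end FreeModules

section MinimalCycles

variable {R : Type*} [CommRing R] [IsLocalRing R] {G : ℕ → Type*} [∀ n, AddCommGroup (G n)]
  [∀ n, Module R (G n)] {d : ∀ n, G (n + 1) →ₗ[R] G n}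

variable (d) in
/-- Every element of `𝔪 G` in positive degree that is a cycle modulo `J` is a boundary
modulo `J`. -/
def MinimalCyclesBound (J : Ideal R) : Prop :=
  ∀ n, ∀ f ∈ maximalIdeal R • (⊤ : Submodule R (G (n + 1))),
    d n f ∈ J • (⊤ : Submodule R (G n)) → f ∈ LinearMap.range (d (n + 1)) ⊔ J • ⊤

lemma minimalCyclesBound_bot (hex : ∀ n, Function.Exact (d (n + 1)) (d n)) :
    MinimalCyclesBound d ⊥ := by
  intro n f _ hdf
  rw [Submodule.bot_smul, Submodule.mem_bot] at hdf
  exact Submodule.mem_sup_left ((hex n f).mp hdf)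

lemma mem_maximalIdeal_of_mul_mem {I : Ideal R} {x s : R} (hx : x ∉ I) (hs : x * s ∈ I) :
    s ∈ maximalIdeal R :=
  (mem_maximalIdeal s).mpr fun hunit ↦ hx ((I.mul_unit_mem_iff_mem hunit).mp hs)

variable [∀ n, Module.Free R (G n)]
  (hmin : ∀ n, LinearMap.range (d n) ≤ maximalIdeal R • ⊤)
  (hzero : maximalIdeal R • ⊤ ≤ LinearMap.range (d 0))
  (hex : ∀ n, Function.Exact (d (n + 1)) (d n))

include hmin hzero hex

lemma MinimalCyclesBound.sup_span_singleton {J : Ideal R} (h : MinimalCyclesBound d J) {x : R}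
    (hx : x ∈ maximalIdeal R) (hreg : ∀ s, x * s ∈ J → s ∈ J) (hxJ : x ∉ J ⊔ maximalIdeal R ^ 2) :
    MinimalCyclesBound d (J ⊔ Ideal.span {x}) := by
  intro n f hf hdf
  rw [Submodule.sup_smul, Submodule.ideal_span_singleton_smul] at hdf
  obtain ⟨p, hp, q, hq, hpq⟩ := Submodule.mem_sup.mp hdf
  obtain ⟨g, -, rfl⟩ := (Submodule.mem_smul_pointwise_iff_exists _ _ _).mp hq
  -- `d f ∈ 𝔪² G` and `x ∉ J + 𝔪²`, so `d f = p + x • g` forces `g ∈ 𝔪 G`.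
  have hgm : g ∈ maximalIdeal R • (⊤ : Submodule R (G n)) := by
    refine mem_ideal_smul_top_of_smul_mem (fun s ↦ mem_maximalIdeal_of_mul_mem hxJ) ?_
    rw [Submodule.sup_smul, ← sub_eq_of_eq_add' hpq.symm]
    exact sub_mem (Submodule.mem_sup_right (map_mem_ideal_sq_smul_top (hmin n) hf))
      (Submodule.mem_sup_left hp)
  have hg : g ∈ LinearMap.range (d n) ⊔ J • ⊤ := by
    cases n with
    | zero => exact Submodule.mem_sup_left (hzero hgm)
    | succ n =>
      refine h n g hgm (mem_ideal_smul_top_of_smul_mem hreg ?_)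
      have hdd := (hex n).apply_apply_eq_zero f
      rw [← hpq, map_add, map_smul] at hdd
      rw [eq_neg_of_add_eq_zero_right hdd]
      exact neg_mem (map_mem_ideal_smul_top _ hp)
  obtain ⟨_, ⟨g', rfl⟩, q, hqJ, rfl⟩ := Submodule.mem_sup.mp hg
  have hsub : f - x • g' ∈ LinearMap.range (d (n + 1)) ⊔ J • ⊤ := by
    refine h n _ (sub_mem hf (Submodule.smul_mem_smul hx Submodule.mem_top)) ?_
    rw [map_sub, map_smul, ← hpq, smul_add, add_sub_assoc, add_sub_cancel_left]
    exact add_mem hp (Submodule.smul_mem _ _ hqJ)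
  rw [Submodule.sup_smul, ← sup_assoc, ← sub_add_cancel f (x • g')]
  exact add_mem (Submodule.mem_sup_left hsub) (Submodule.mem_sup_right
    (Submodule.smul_mem_smul (Ideal.mem_span_singleton_self x) Submodule.mem_top))

lemma minimalCyclesBound_ofList_take {xs : List R} (hmem : ∀ r ∈ xs, r ∈ maximalIdeal R)
    (hreg : IsWeaklyRegular R xs) (hind : IsIndependentModSq xs) {j : ℕ} (hj : j ≤ xs.length) :
    MinimalCyclesBound d (Ideal.ofList (xs.take j)) := by
  induction j with
  | zero => simpa using minimalCyclesBound_bot hex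
  | succ j ih =>
    rw [List.take_succ_eq_append_getElem hj, Ideal.ofList_append, Ideal.ofList_singleton]
    refine (ih (Nat.le_of_succ_le hj)).sup_span_singleton hmin hzero hex
      (hmem _ (List.getElem_mem hj)) (fun s hs ↦ ?_) (hind j hj)
    simpa using mem_of_isSMulRegular_quotient_of_smul_mem (hreg.regular_mod_prev j hj)
      (by simpa using hs)

theorem IsMinimalReduction.maximalIdeal_smul_top_le_range_sup [IsNoetherianRing R] {xs : List R}
    (hxs : IsMinimalReduction xs) (n : ℕ) :
    maximalIdeal R • ⊤ ≤ LinearMap.range (d n) ⊔ Ideal.ofList xs • ⊤ := by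
  cases n with
  | zero => exact hzero.trans le_sup_left
  | succ n =>
    intro f hf
    have hbound := minimalCyclesBound_ofList_take hmin hzero hex hxs.mem_maximalIdeal
      hxs.isWeaklyRegular hxs.isIndependentModSq le_rfl
    rw [List.take_length] at hbound
    exact hbound n f hf (Submodule.smul_mono_left hxs.sq_le (map_mem_ideal_sq_smul_top (hmin n) hf))

end MinimalCycles

section BaseChange

variable {R S : Type*} [CommRing R] [CommRing S] [Algebra R S] {M N : Type*} [AddCommGroup M]
  [Module R M] [AddCommGroup N] [Module R N]

lemma tmul_mem_map_smul_top {I : Ideal R} {v : M} (hv : v ∈ (I • ⊤ : Submodule R M)) (s : S) :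
    s ⊗ₜ[R] v ∈ (I.map (algebraMap R S) • ⊤ : Submodule S (S ⊗[R] M)) := by
  induction hv using Submodule.smul_induction_on' with
  | smul r hr w _ =>
    rw [← smul_tmul, algebra_compatible_smul S r s, ← smul_tmul']
    exact Submodule.smul_mem_smul (Ideal.mem_map_of_mem _ hr) Submodule.mem_top
  | add x _ y _ hx hy =>
    rw [tmul_add]
    exact add_mem hx hy

lemma range_baseChange_le {f : M →ₗ[R] N} {I : Ideal R} (h : LinearMap.range f ≤ I • ⊤) :
    LinearMap.range (f.baseChange S) ≤ I.map (algebraMap R S) • ⊤ := by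
  rintro _ ⟨w, rfl⟩
  induction w with
  | zero => simp
  | tmul s v => exact tmul_mem_map_smul_top (h ⟨v, rfl⟩) s
  | add x y hx hy =>
    rw [map_add]
    exact add_mem hx hy

lemma map_smul_top_le_range_baseChange {f : M →ₗ[R] N} {I : Ideal R}
    (h : I • ⊤ ≤ LinearMap.range f) :
    I.map (algebraMap R S) • ⊤ ≤ LinearMap.range (f.baseChange S) := by
  suffices hmem : ∀ a ∈ I, ∀ g : S ⊗[R] N,
      algebraMap R S a • g ∈ LinearMap.range (f.baseChange S) by
    rw [Submodule.smul_le]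
    intro r hr g _
    have hle : I.map (algebraMap R S) ≤ (LinearMap.range (f.baseChange S)).colon {g} :=
      Ideal.map_le_iff_le_comap.mpr fun a ha ↦
        Submodule.mem_colon_singleton.mpr (hmem a ha g)
    exact Submodule.mem_colon_singleton.mp (hle hr)
  intro a ha g
  induction g with
  | zero => simp
  | tmul s v =>
    obtain ⟨w, hw⟩ := h (Submodule.smul_mem_smul ha (Submodule.mem_top (x := v)))
    refine ⟨s ⊗ₜ w, ?_⟩
    rw [LinearMap.baseChange_tmul, hw, ← smul_tmul, algebra_compatible_smul S a s, smul_tmul']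
  | add x y hx hy =>
    rw [smul_add]
    exact add_mem hx hy

lemma smul_top_le_smul_top_of_surjective {f : M →ₗ[R] N} (hf : Function.Surjective f)
    {I J : Ideal R} (h : I • (⊤ : Submodule R M) ≤ LinearMap.ker f ⊔ J • ⊤) :
    I • (⊤ : Submodule R N) ≤ J • ⊤ := by
  have hker : (LinearMap.ker f).map f = ⊥ :=
    le_bot_iff.mp (by rintro _ ⟨y, hy, rfl⟩; exact hy)
  have hmap := Submodule.map_mono (f := f) h
  rwa [Submodule.map_smul'', Submodule.map_sup, Submodule.map_smul'', Submodule.map_top,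
    LinearMap.range_eq_top.mpr hf, hker, bot_sup_eq] at hmap

end BaseChange

section SyzygyModules

variable {R : Type u} [CommRing R] [IsLocalRing R]

lemma MinimalFreeResolution.exists_surjective_syzygy {M : Type u} [AddCommGroup M] [Module R M]
    (F : MinimalFreeResolution R M) (n : ℕ) :
    ∃ g : (Fin (F.rank n) → R) →ₗ[R] F.syzygy n,
      Function.Surjective g ∧ Function.Exact (F.d n) g := by
  cases n with
  | zero =>
    exact ⟨F.ε.rangeRestrict, F.ε.surjective_rangeRestrict,
      fun y ↦ Subtype.ext_iff.trans (F.exact_ε y)⟩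
  | succ n =>
    exact ⟨(F.d n).rangeRestrict, (F.d n).surjective_rangeRestrict,
      fun y ↦ Subtype.ext_iff.trans (F.exact_d n y)⟩

lemma MinimalFreeResolution.maximalIdeal_smul_top_le_range
    (F : MinimalFreeResolution R (ResidueField R)) :
    maximalIdeal R • ⊤ ≤ LinearMap.range (F.d 0) := by
  rw [Submodule.smul_le]
  intro a ha v _
  refine (F.exact_ε _).mp ?_
  rw [map_smul, algebra_compatible_smul (ResidueField R), ResidueField.algebraMap_eq,
    (residue_eq_zero_iff a).mpr ha, zero_smul]

variable {S : Type u} [CommRing S] [IsLocalRing S] [IsNoetherianRing S] [Algebra R S]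
  [Module.Flat R S] (hm : (maximalIdeal R).map (algebraMap R S) = maximalIdeal S)
  {xs : List S} (hxs : IsMinimalReduction xs)

include hm hxs

lemma MinimalFreeResolution.maximalIdeal_smul_tensorProduct_syzygy_le
    (F : MinimalFreeResolution R (ResidueField R)) (n : ℕ) :
    maximalIdeal S • (⊤ : Submodule S (S ⊗[R] F.syzygy n)) ≤ Ideal.ofList xs • ⊤ := by
  have hle := hxs.maximalIdeal_smul_top_le_range_sup
    (G := fun n ↦ S ⊗[R] (Fin (F.rank n) → R)) (d := fun n ↦ (F.d n).baseChange S)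
    (fun n ↦ hm ▸ range_baseChange_le (F.minimal n))
    (hm ▸ map_smul_top_le_range_baseChange F.maximalIdeal_smul_top_le_range)
    (fun n ↦ Module.Flat.lTensor_exact S (F.exact_d n)) n
  obtain ⟨g, hg, hgex⟩ := F.exists_surjective_syzygy n
  refine smul_top_le_smul_top_of_surjective (f := g.baseChange S)
    (LinearMap.lTensor_surjective S hg) (hle.trans ?_)
  gcongr
  rintro _ ⟨w, rfl⟩
  exact (lTensor_exact S hgex hg).apply_apply_eq_zero w

lemma IsImageOfSyzygies.maximalIdeal_smul_tensorProduct_le {M : Type u} [AddCommGroup M]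
    [Module R M] (h : IsImageOfSyzygies R M) :
    maximalIdeal S • (⊤ : Submodule S (S ⊗[R] M)) ≤ Ideal.ofList xs • ⊤ := by
  obtain ⟨F, r, n, f, hf⟩ := h
  rw [Submodule.smul_le]
  rintro a ha w -
  induction w with
  | zero => simp
  | add x y hx hy =>
    rw [smul_add]
    exact add_mem hx hy
  | tmul s v =>
    obtain ⟨z, rfl⟩ := hf v
    induction z using DirectSum.induction_on with
    | zero => simp
    | add x y hx hy =>
      rw [map_add, tmul_add, smul_add]
      exact add_mem hx hy
    | of i z =>
      let ι := f ∘ₗ DirectSum.lof R (Fin r) (fun i ↦ F.syzygy (n i)) i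
      simpa [ι, DirectSum.lof_eq_of] using map_mem_ideal_smul_top (ι.baseChange S)
        (F.maximalIdeal_smul_tensorProduct_syzygy_le hm hxs (n i)
          (Submodule.smul_mem_smul ha (Submodule.mem_top (x := s ⊗ₜ[R] z))))

end SyzygyModules

section MatrixAction

variable {R : Type*} [CommRing R] {a b c : Type*} [Fintype b]
  {W V U : Type*} [AddCommGroup W] [Module R W] [AddCommGroup V] [Module R V] [AddCommGroup U]
  [Module R U]

/-- The action of a matrix on column vectors with entries in a module. -/
def matrixAction (A : Matrix a b R) (W : Type*) [AddCommGroup W] [Module R W] :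
    (b → W) →ₗ[R] (a → W) :=
  LinearMap.pi fun i ↦ ∑ j, A i j • LinearMap.proj j

@[simp]
lemma matrixAction_apply (A : Matrix a b R) (v : b → W) (i : a) :
    matrixAction A W v i = ∑ j, A i j • v j := by
  simp [matrixAction]

lemma matrixAction_compLeft (f : W →ₗ[R] V) (A : Matrix a b R) (v : b → W) :
    matrixAction A V (f.compLeft b v) = f.compLeft a (matrixAction A W v) := by
  ext i
  simp

lemma exact_compLeft {f : W →ₗ[R] V} {g : V →ₗ[R] U} (h : Function.Exact f g) :
    Function.Exact (f.compLeft a) (g.compLeft a) := by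
  refine fun v ↦ ⟨fun hv ↦ ?_, ?_⟩
  · choose w hw using fun i ↦ (h (v i)).mp (congrFun hv i)
    exact ⟨w, funext hw⟩
  · rintro ⟨w, rfl⟩
    exact funext fun i ↦ h.apply_apply_eq_zero (w i)

variable [Fintype a]

lemma exact_matrixAction_congr (f : W ≃ₗ[R] V) {A : Matrix b a R} {B : Matrix c b R}
    (h : Function.Exact (matrixAction A W) (matrixAction B W)) :
    Function.Exact (matrixAction A V) (matrixAction B V) := by
  refine (Function.Exact.iff_of_ladder_linearEquiv (e₁ := LinearEquiv.piCongrRight fun _ ↦ f)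
    (e₂ := LinearEquiv.piCongrRight fun _ ↦ f) (e₃ := LinearEquiv.piCongrRight fun _ ↦ f)
    ?_ ?_).mpr h
  all_goals
    ext v i
    simp

lemma exact_matrixAction_tensorProduct [Finite c] {S : Type*} [CommRing S] [Algebra R S]
    [Module.Flat R S] {A : Matrix b a R} {B : Matrix c b R}
    (h : Function.Exact (matrixAction A W) (matrixAction B W)) :
    Function.Exact (matrixAction A (S ⊗[R] W)) (matrixAction B (S ⊗[R] W)) := by
  classical
  have := Fintype.ofFinite c
  refine (Function.Exact.iff_of_ladder_linearEquiv
    (e₁ := TensorProduct.piRight R R S fun _ : a ↦ W)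
    (e₂ := TensorProduct.piRight R R S fun _ : b ↦ W)
    (e₃ := TensorProduct.piRight R R S fun _ : c ↦ W) ?_ ?_).mpr (Module.Flat.lTensor_exact S h)
  all_goals
    refine TensorProduct.ext' fun s w ↦ funext fun i ↦ ?_
    simp [tmul_sum]

lemma isEmpty_of_exact_matrixAction [Nontrivial W] {A : Matrix b a R} {B : Matrix c b R}
    (hA : ∀ i j (w : W), A i j • w = 0) (hB : ∀ i j (w : W), B i j • w = 0)
    (h : Function.Exact (matrixAction A W) (matrixAction B W)) : IsEmpty b := by
  by_contra! hb
  obtain ⟨i⟩ := hb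
  obtain ⟨w, hw⟩ := exists_ne (0 : W)
  obtain ⟨v, hv⟩ := (h fun _ ↦ w).mp (by ext; simp [hB])
  exact hw (by simpa [hA] using (congrFun hv i).symm)

lemma exact_matrixAction_of_shortExact {e : Type*} [Fintype c] {A : Matrix b a R}
    {B : Matrix c b R} {C : Matrix e c R} {f : W →ₗ[R] W} {g : W →ₗ[R] V}
    (hf : Function.Injective f) (hg : Function.Surjective g) (hfg : Function.Exact f g)
    (hAB : Function.Exact (matrixAction A W) (matrixAction B W))
    (hBC : Function.Exact (matrixAction B W) (matrixAction C W)) :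
    Function.Exact (matrixAction A V) (matrixAction B V) := by
  refine fun v ↦ ⟨fun hv ↦ ?_, ?_⟩
  · obtain ⟨u, rfl : g.compLeft b u = v⟩ := hg.comp_left v
    rw [matrixAction_compLeft] at hv
    obtain ⟨w, hw⟩ := (exact_compLeft hfg _).mp hv
    have hCw : matrixAction C W w = 0 := by
      refine hf.comp_left (?_ : f.compLeft e _ = f.compLeft e 0)
      rw [← matrixAction_compLeft, hw, hBC.apply_apply_eq_zero, map_zero]
    obtain ⟨t, rfl⟩ := (hBC w).mp hCw
    have hker : matrixAction B W (u - f.compLeft b t) = 0 := by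
      rw [map_sub, matrixAction_compLeft, hw, sub_self]
    obtain ⟨s, hs⟩ := (hAB _).mp hker
    refine ⟨g.compLeft a s, ?_⟩
    rw [matrixAction_compLeft, hs, map_sub, (exact_compLeft hfg).apply_apply_eq_zero, sub_zero]
  · rintro ⟨s, rfl⟩
    obtain ⟨s, rfl : g.compLeft a _ = _⟩ := hg.comp_left s
    rw [matrixAction_compLeft, matrixAction_compLeft, hAB.apply_apply_eq_zero, map_zero]

end MatrixAction

section MatrixActionModRegular

variable {R S W : Type*} [CommRing R] [CommRing S] [Algebra R S] [AddCommGroup W] [Module R W]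
  [Module S W] [IsScalarTower R S W]

section Exact

variable {a b c e : Type*} [Fintype a] [Fintype b] [Fintype c] {A : Matrix b a R} {B : Matrix c b R}
  {C : Matrix e c R} {x : S}

lemma exact_matrixAction_of_exact_lsmul {V : Type*} [AddCommGroup V] [Module R V] [Module S V]
    [IsScalarTower R S V] {g : W →ₗ[S] V} (hx : IsSMulRegular W x) (hg : Function.Surjective g)
    (hxg : Function.Exact (LinearMap.lsmul S W x) g)
    (hAB : Function.Exact (matrixAction A W) (matrixAction B W))
    (hBC : Function.Exact (matrixAction B W) (matrixAction C W)) :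
    Function.Exact (matrixAction A V) (matrixAction B V) :=
  exact_matrixAction_of_shortExact (f := (LinearMap.lsmul S W x).restrictScalars R)
    (g := g.restrictScalars R) hx hg hxg hAB hBC

lemma exact_matrixAction_quotSMulTop (hx : IsSMulRegular W x)
    (hAB : Function.Exact (matrixAction A W) (matrixAction B W))
    (hBC : Function.Exact (matrixAction B W) (matrixAction C W)) :
    Function.Exact (matrixAction A (QuotSMulTop x W)) (matrixAction B (QuotSMulTop x W)) := by
  have hexact := LinearMap.exact_lsmul_mkQ_smul_top W x
  exact exact_matrixAction_of_exact_lsmul hx (Submodule.mkQ_surjective _) hexact hAB hBC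

end Exact

variable (R W)

/-- Dividing out a sequence one element at a time. -/
def quotOfListConsEquiv (x : S) (xs : List S) :
    (QuotSMulTop x W ⧸ (Ideal.ofList xs • ⊤ : Submodule S (QuotSMulTop x W))) ≃ₗ[R]
      W ⧸ (Ideal.ofList (x :: xs) • ⊤ : Submodule S W) :=
  (Submodule.quotOfListConsSMulTopEquivQuotSMulTopInner W x xs).symm.restrictScalars R

variable (S) in
/-- Dividing out the empty sequence. -/
def quotOfListNilEquiv : W ≃ₗ[R] W ⧸ (Ideal.ofList ([] : List S) • ⊤ : Submodule S W) :=
  (Submodule.quotEquivOfEqBot (Ideal.ofList ([] : List S) • ⊤ : Submodule S W)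
    (by rw [Ideal.ofList_nil, Submodule.bot_smul])).symm.restrictScalars R

variable {R W} {ι : ℕ → Type*} [∀ j, Fintype (ι j)]

lemma exact_matrixAction_quotient_of_cochain (B : ∀ j, Matrix (ι (j + 1)) (ι j) R) {xs : List S}
    (hxs : IsWeaklyRegular W xs) (n : ℕ) (h : ∀ j, n ≤ j → j ≤ n + xs.length →
      Function.Exact (matrixAction (B j) W) (matrixAction (B (j + 1)) W)) :
    Function.Exact (matrixAction (B n) (W ⧸ (Ideal.ofList xs • ⊤ : Submodule S W)))
      (matrixAction (B (n + 1)) (W ⧸ (Ideal.ofList xs • ⊤ : Submodule S W))) := by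
  induction xs generalizing W with
  | nil => exact exact_matrixAction_congr (quotOfListNilEquiv R S W) (h n le_rfl (by simp))
  | cons x xs ih =>
    obtain ⟨hx, hxs⟩ := (isWeaklyRegular_cons_iff W x xs).mp hxs
    rw [List.length_cons] at h
    refine exact_matrixAction_congr (quotOfListConsEquiv R W x xs) (ih hxs fun j hnj hjn ↦ ?_)
    exact exact_matrixAction_quotSMulTop hx (h j hnj (by lia)) (h (j + 1) (by lia) (by lia))

lemma exact_matrixAction_quotient_of_chain (A : ∀ j, Matrix (ι j) (ι (j + 1)) R) {xs : List S}
    (hxs : IsWeaklyRegular W xs) {n k : ℕ} (hk : n + xs.length = k) (h : ∀ j, n ≤ j → j ≤ k →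
      Function.Exact (matrixAction (A (j + 1)) W) (matrixAction (A j) W)) :
    Function.Exact (matrixAction (A (k + 1)) (W ⧸ (Ideal.ofList xs • ⊤ : Submodule S W)))
      (matrixAction (A k) (W ⧸ (Ideal.ofList xs • ⊤ : Submodule S W))) := by
  induction xs generalizing W n with
  | nil =>
    rw [List.length_nil] at hk
    exact exact_matrixAction_congr (quotOfListNilEquiv R S W) (h k (by lia) le_rfl)
  | cons x xs ih =>
    obtain ⟨hx, hxs⟩ := (isWeaklyRegular_cons_iff W x xs).mp hxs
    rw [List.length_cons] at hk
    refine exact_matrixAction_congr (quotOfListConsEquiv R W x xs)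
      (ih hxs (n := n + 1) (by lia) fun j hnj hjk ↦ ?_)
    obtain ⟨j, rfl⟩ := Nat.exists_eq_add_of_le' (Nat.le_of_add_left_le hnj)
    exact exact_matrixAction_quotSMulTop hx (h (j + 1) (by lia) hjk) (h j (by lia) (by lia))

end MatrixActionModRegular

section Existence

variable {R : Type u} [CommRing R] [IsLocalRing R]

lemma exists_minimal_cover (M : Type*) [AddCommGroup M] [Module R M] [Module.Finite R M] :
    ∃ (n : ℕ) (p : (Fin n → R) →ₗ[R] M), Function.Surjective p ∧
      LinearMap.ker p ≤ maximalIdeal R • ⊤ := by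
  let b := Module.finBasis (ResidueField R) (ResidueField R ⊗[R] M)
  choose m hm using fun i ↦
    TensorProduct.mk_surjective R M (ResidueField R) Ideal.Quotient.mk_surjective (b i)
  refine ⟨_, Fintype.linearCombination R m, ?_, fun v hv ↦ ?_⟩
  · rw [← LinearMap.range_eq_top, Fintype.range_linearCombination]
    exact span_eq_top_of_tmul_eq_basis m b hm
  · have hcomb : ∑ i, residue R (v i) • b i = 0 := by
      calc ∑ i, residue R (v i) • b i = (1 : ResidueField R) ⊗ₜ[R] ∑ i, v i • m i := by
            simp_rw [tmul_sum, tmul_smul, ← hm]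
            rfl
        _ = 0 := by rw [← Fintype.linearCombination_apply, LinearMap.mem_ker.mp hv, tmul_zero]
    refine (mem_ideal_smul_top_iff_repr (Pi.basisFun R _) _ _).mpr fun i ↦ ?_
    rw [Pi.basisFun_repr, ← residue_eq_zero_iff]
    exact Fintype.linearIndependent_iff.mp b.linearIndependent _ hcomb i

lemma exists_linearMap_range_eq_ker_le {a : ℕ} (K : Submodule R (Fin a → R))
    [Module.Finite R K] : ∃ (n : ℕ) (f : (Fin n → R) →ₗ[R] (Fin a → R)),
      LinearMap.range f = K ∧ LinearMap.ker f ≤ maximalIdeal R • ⊤ := by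
  obtain ⟨n, p, hp, hker⟩ := exists_minimal_cover (R := R) K
  refine ⟨n, K.subtype ∘ₗ p, ?_, ?_⟩
  · rw [LinearMap.range_comp_of_range_eq_top _ (LinearMap.range_eq_top.mpr hp),
      Submodule.range_subtype]
  · rwa [LinearMap.ker_comp_of_ker_eq_bot _ K.ker_subtype]

theorem nonempty_minimalFreeResolution [IsNoetherianRing R] (M : Type u) [AddCommGroup M]
    [Module R M] [Module.Finite R M] : Nonempty (MinimalFreeResolution R M) := by
  obtain ⟨n₀, ε, hε, hker⟩ := exists_minimal_cover (R := R) M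
  choose rank d hrange hmin using fun K : Σ a : ℕ, Submodule R (Fin a → R) ↦
    exists_linearMap_range_eq_ker_le K.2
  let K (n : ℕ) : Σ a : ℕ, Submodule R (Fin a → R) :=
    Nat.rec ⟨n₀, LinearMap.ker ε⟩ (fun _ K ↦ ⟨rank K, LinearMap.ker (d K)⟩) n
  have hK (n : ℕ) : (K n).2 ≤ maximalIdeal R • ⊤ := by
    cases n with
    | zero => exact hker
    | succ n => exact hmin (K n)
  exact ⟨{
    rank n := (K n).1
    d n := d (K n)
    ε
    surjective_ε := hε
    exact_ε := LinearMap.exact_iff.mpr (hrange (K 0)).symm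
    exact_d n := LinearMap.exact_iff.mpr (hrange (K (n + 1))).symm
    minimal n := (hrange (K n)).trans_le (hK n) }⟩

end Existence

section ProjectiveResolution

lemma quasiIsoAt_zero_toSingle {C : Type*} [Category C] [Abelian C] {K : ChainComplex C ℕ} {Z : C}
    (π : K ⟶ (ChainComplex.single₀ C).obj Z) {φ : K.X 0 ⟶ Z} (hφ : K.d 1 0 ≫ φ = 0)
    (hπ : π.f 0 = φ) (hexact : (ShortComplex.mk _ _ hφ).Exact) (hepi : Epi φ) :
    QuasiIsoAt π 0 := by
  subst hπ
  rw [ChainComplex.quasiIsoAt₀_iff,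
    ShortComplex.quasiIso_iff_of_zeros' _ (K.shape _ _ (by simp)) rfl rfl]
  exact ⟨hexact, hepi⟩

namespace MinimalFreeResolution

variable {R : Type u} [CommRing R] [IsLocalRing R] {M : Type u} [AddCommGroup M] [Module R M]
  (F : MinimalFreeResolution R M)

/-- The chain complex of free modules underlying a minimal free resolution, without its
augmentation. -/
def complex : ChainComplex (ModuleCat.{u} R) ℕ :=
  ChainComplex.of (fun n ↦ ModuleCat.of R (Fin (F.rank n) → R)) (fun n ↦ ModuleCat.ofHom (F.d n))
    fun n ↦ by
      rw [← ModuleCat.ofHom_comp, (F.exact_d n).linearMap_comp_eq_zero]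
      rfl

lemma complex_d (n : ℕ) : F.complex.d (n + 1) n = ModuleCat.ofHom (F.d n) :=
  ChainComplex.of_d (fun n ↦ ModuleCat.of R (Fin (F.rank n) → R))
    (fun n ↦ ModuleCat.ofHom (F.d n)) n

lemma exactAt_complex (n : ℕ) : F.complex.ExactAt (n + 1) := by
  rw [HomologicalComplex.exactAt_iff' _ (n + 1 + 1) (n + 1) n (by simp) (by simp)]
  refine ModuleCat.shortComplex_exact _ ?_
  change Function.Exact (F.complex.d (n + 1 + 1) (n + 1)).hom (F.complex.d (n + 1) n).hom
  rw [F.complex_d, F.complex_d]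
  exact F.exact_d n

lemma complex_d_comp_ε : F.complex.d 1 0 ≫ ModuleCat.ofHom F.ε = 0 := by
  rw [F.complex_d]
  change ModuleCat.ofHom (F.ε ∘ₗ F.d 0) = 0
  rw [F.exact_ε.linearMap_comp_eq_zero]
  rfl

lemma exact_complex_d_ε : (ShortComplex.mk _ _ F.complex_d_comp_ε).Exact := by
  refine ModuleCat.shortComplex_exact _ ?_
  change Function.Exact (F.complex.d (0 + 1) 0).hom F.ε
  rw [F.complex_d]
  exact F.exact_ε

/-- A minimal free resolution as a projective resolution in the category of modules, the form in
which Mathlib computes `Ext` and `Tor`. -/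
def projectiveResolution : ProjectiveResolution (ModuleCat.of R M) where
  complex := F.complex
  projective n := ModuleCat.projective_of_free (Pi.basisFun R (Fin (F.rank n)))
  π := (ChainComplex.toSingle₀Equiv _ _).symm ⟨ModuleCat.ofHom F.ε, F.complex_d_comp_ε⟩
  quasiIso := ⟨fun n ↦ by
    cases n with
    | zero =>
      exact quasiIsoAt_zero_toSingle _ F.complex_d_comp_ε
        (ChainComplex.toSingle₀Equiv_symm_apply_f_zero _ _) F.exact_complex_d_ε
        ((ModuleCat.epi_iff_surjective _).mpr F.surjective_ε)
    | succ n =>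
      rw [quasiIsoAt_iff_exactAt' _ _ (ChainComplex.exactAt_succ_single_obj _ _)]
      exact F.exactAt_complex n⟩

variable {N : Type u} [AddCommGroup N] [Module R N]

lemma exists_comp_d_eq_of_extVanishes {i : ℕ} (h : ExtVanishes R M N (i + 1))
    {φ : (Fin (F.rank (i + 1)) → R) →ₗ[R] N} (hφ : φ ∘ₗ F.d (i + 1) = 0) :
    ∃ ψ : (Fin (F.rank i) → R) →ₗ[R] N, ψ ∘ₗ F.d i = φ := by
  have hcocycle : F.complex.d (i + 1 + 1) (i + 1) ≫ ModuleCat.ofHom φ = 0 := by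
    rw [F.complex_d]
    change ModuleCat.ofHom (φ ∘ₗ F.d (i + 1)) = 0
    rw [hφ]
    rfl
  obtain ⟨ψ, hψ⟩ := (F.projectiveResolution.extMk_eq_zero_iff (Y := ModuleCat.of R N)
    (ModuleCat.ofHom φ) (i + 2) rfl hcocycle i rfl).mp (h.elim _ _)
  change F.complex.d (i + 1) i ≫ ψ = _ at hψ
  rw [F.complex_d] at hψ
  exact ⟨ψ.hom, congrArg ModuleCat.Hom.hom hψ⟩

lemma exact_lTensor_of_torVanishes {i : ℕ} (h : TorVanishes R N M (i + 1)) :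
    Function.Exact ((F.d (i + 1)).lTensor N) ((F.d i).lTensor N) := by
  let T : ModuleCat.{u} R ⥤ ModuleCat.{u} R :=
    (MonoidalCategory.tensoringLeft _).obj (ModuleCat.of R N)
  have hexactAt : ((T.mapHomologicalComplex _).obj F.complex).ExactAt (i + 1) :=
    (HomologicalComplex.exactAt_iff_isZero_homology _ _).mpr
      (h.of_iso (F.projectiveResolution.isoLeftDerivedObj T (i + 1)).symm)
  rw [HomologicalComplex.exactAt_iff' _ (i + 1 + 1) (i + 1) i (by simp) (by simp)] at hexactAt
  have hexact := (ShortComplex.ShortExact.moduleCat_exact_iff_function_exact _).mp hexactAt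
  change Function.Exact (T.map (F.complex.d (i + 1 + 1) (i + 1))).hom
    (T.map (F.complex.d (i + 1) i)).hom at hexact
  rw [F.complex_d, F.complex_d] at hexact
  exact hexact

end MinimalFreeResolution

variable {R : Type u} [CommRing R] (M N : Type u) [AddCommGroup M] [Module R M] [AddCommGroup N]
  [Module R N]

lemma extVanishes_of_free [Module.Free R M] (i : ℕ) : ExtVanishes R M N (i + 1) :=
  have : Projective (ModuleCat.of R M) :=
    ModuleCat.projective_of_free (Module.Free.chooseBasis R M)
  Abelian.Ext.subsingleton_of_projective _ _ i

lemma torVanishes_of_free [Module.Free R N] (i : ℕ) : TorVanishes R M N (i + 1) :=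
  have : Projective (ModuleCat.of R N) :=
    ModuleCat.projective_of_free (Module.Free.chooseBasis R N)
  isZero_Tor_succ_of_projective (ModuleCat.{u} R) _ _ i

end ProjectiveResolution

section MatrixOfDifferential

variable {R : Type*} [CommRing R] {a b c : Type*} [Fintype a] {N : Type*} [AddCommGroup N]
  [Module R N]

lemma linearCombination_bijective :
    Function.Bijective fun v : a → N ↦ Fintype.linearCombination R v := by
  classical
  refine ⟨fun v w h ↦ funext fun i ↦ ?_, fun f ↦ ⟨fun i ↦ f (Pi.single i 1), ?_⟩⟩
  · simpa using LinearMap.congr_fun h (Pi.single i 1)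
  · exact (Pi.basisFun R a).ext fun i ↦ by simp

variable [Fintype b] [DecidableEq a]

lemma linearCombination_comp (f : (a → R) →ₗ[R] (b → R)) (v : b → N) :
    Fintype.linearCombination R v ∘ₗ f =
      Fintype.linearCombination R (matrixAction f.toMatrix'.transpose N v) := by
  refine (Pi.basisFun R a).ext fun i ↦ ?_
  simp [Fintype.linearCombination_apply, LinearMap.toMatrix'_apply, Pi.single_apply]

variable [DecidableEq b]

lemma matrixAction_comp_piScalarRight (f : (a → R) →ₗ[R] (b → R)) :
    matrixAction f.toMatrix' N ∘ₗ (TensorProduct.piScalarRight R R N a).toLinearMap =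
      (TensorProduct.piScalarRight R R N b).toLinearMap ∘ₗ f.lTensor N := by
  refine TensorProduct.ext' fun n v ↦ funext fun i ↦ ?_
  have hfv : f v i = ∑ j, f.toMatrix' i j * v j := congrFun (f.toMatrix'_mulVec v).symm i
  simp [hfv, Finset.sum_smul, mul_smul]

variable {f : (a → R) →ₗ[R] (b → R)} {g : (b → R) →ₗ[R] (c → R)}

lemma exact_matrixAction_transpose [Fintype c] (hgf : g ∘ₗ f = 0)
    (h : ∀ φ : (b → R) →ₗ[R] N, φ ∘ₗ f = 0 → ∃ ψ : (c → R) →ₗ[R] N, ψ ∘ₗ g = φ) :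
    Function.Exact (matrixAction g.toMatrix'.transpose N)
      (matrixAction f.toMatrix'.transpose N) := by
  classical
  refine fun v ↦ ⟨fun hv ↦ ?_, ?_⟩
  · obtain ⟨ψ, hψ⟩ := h (Fintype.linearCombination R v) (by
      rw [linearCombination_comp, hv]
      ext
      simp)
    obtain ⟨w, rfl⟩ := linearCombination_bijective.surjective ψ
    rw [linearCombination_comp] at hψ
    exact ⟨w, linearCombination_bijective.injective hψ⟩
  · rintro ⟨w, rfl⟩
    apply (linearCombination_bijective (R := R)).injective
    dsimp only
    rw [← linearCombination_comp, ← linearCombination_comp, LinearMap.comp_assoc, hgf]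
    ext
    simp

lemma exact_matrixAction_of_lTensor [Finite c]
    (h : Function.Exact (f.lTensor N) (g.lTensor N)) :
    Function.Exact (matrixAction f.toMatrix' N) (matrixAction g.toMatrix' N) := by
  classical
  have := Fintype.ofFinite c
  exact (Function.Exact.iff_of_ladder_linearEquiv (matrixAction_comp_piScalarRight f)
    (matrixAction_comp_piScalarRight g)).mpr h

end MatrixOfDifferential

section WeaklyRegular

variable {S : Type*} [CommRing S] {A B C : Type*} [AddCommGroup A] [Module S A]
  [AddCommGroup B] [Module S B] [AddCommGroup C] [Module S C] {xs : List S}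

lemma isWeaklyRegular_of_flat [Module.Flat S A] (h : IsWeaklyRegular S xs) :
    IsWeaklyRegular A xs :=
  ((TensorProduct.rid S A).isWeaklyRegular_congr xs).mp h.isWeaklyRegular_lTensor

lemma exact_zero_of_injective {f : A →ₗ[S] B} (hf : Function.Injective f) :
    Function.Exact (0 : A →ₗ[S] A) f := by
  intro x
  simp [map_eq_zero_iff f hf, eq_comm]

variable {f : A →ₗ[S] B} {g : B →ₗ[S] C} (hf : Function.Injective f)
  (hg : Function.Surjective g) (hfg : Function.Exact f g)

include hf hg hfg

lemma mem_smul_top_of_map_mem (hC : IsWeaklyRegular C xs) {a : A}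
    (ha : f a ∈ (Ideal.ofList xs • ⊤ : Submodule S B)) :
    a ∈ (Ideal.ofList xs • ⊤ : Submodule S A) := by
  have hmodExact := map_first_exact_on_four_term_right_exact_of_isSMulRegular_last
    (exact_zero_of_injective hf) hfg hg hC
  obtain ⟨y, hy⟩ := (hmodExact (Submodule.Quotient.mk a)).mp (by
    rw [Submodule.mapQ_apply]
    exact (Submodule.Quotient.mk_eq_zero _).mpr ha)
  obtain ⟨y, rfl⟩ := Submodule.Quotient.mk_surjective _ y
  rw [Submodule.mapQ_apply, LinearMap.zero_apply, Submodule.Quotient.mk_zero] at hy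
  exact (Submodule.Quotient.mk_eq_zero _).mp hy.symm

lemma isWeaklyRegular_of_exact (hB : IsWeaklyRegular B xs) (hC : IsWeaklyRegular C xs) :
    IsWeaklyRegular A xs := by
  induction xs generalizing A B C with
  | nil => exact .nil _ _
  | cons x xs ih =>
    obtain ⟨hxB, hB⟩ := (isWeaklyRegular_cons_iff B x xs).mp hB
    obtain ⟨hxC, hC⟩ := (isWeaklyRegular_cons_iff C x xs).mp hC
    refine (isWeaklyRegular_cons_iff A x xs).mpr ⟨hxB.of_injective f hf, ?_⟩
    refine ih (f := QuotSMulTop.map x f) (g := QuotSMulTop.map x g) ?_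
      (QuotSMulTop.map_surjective x hg) (QuotSMulTop.map_exact x hfg hg) hB hC
    have hmodExact := QuotSMulTop.map_first_exact_on_four_term_exact_of_isSMulRegular_last
      (exact_zero_of_injective hf) hfg hxC
    rw [map_zero] at hmodExact
    rw [injective_iff_map_eq_zero]
    intro y hy
    obtain ⟨_, hz⟩ := (hmodExact y).mp hy
    exact hz.symm

variable [IsLocalRing S]

lemma maximalIdeal_le_of_injective [Module.Free S A] [Nontrivial A] (hC : IsWeaklyRegular C xs)
    (hmin : LinearMap.range f ≤ maximalIdeal S • ⊤) (hsq : maximalIdeal S ^ 2 ≤ Ideal.ofList xs) :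
    maximalIdeal S ≤ Ideal.ofList xs :=
  le_of_smul_top_le (G := A) fun _ ha ↦ mem_smul_top_of_map_mem hf hg hfg hC
    (Submodule.smul_mono_left hsq (map_mem_ideal_sq_smul_top hmin ha))

lemma subsingleton_of_range_le [Module.Finite S A] (hmem : ∀ r ∈ xs, r ∈ maximalIdeal S)
    (hC : IsWeaklyRegular C xs) (hle : LinearMap.range f ≤ Ideal.ofList xs • ⊤) :
    Subsingleton A := by
  by_contra! hA
  exact Submodule.top_ne_ideal_smul_of_le_jacobson_annihilator
    ((ofList_le_maximalIdeal hmem).trans (maximalIdeal_le_jacobson _))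
    (top_le_iff.mp fun a _ ↦ mem_smul_top_of_map_mem hf hg hfg hC (hle ⟨a, rfl⟩)).symm

end WeaklyRegular

section Ulrich

variable {S : Type*} [CommRing S] [IsLocalRing S] {xs : List S} {W : Type*} [AddCommGroup W]
  [Module S W]

variable (xs W) in
/-- `W` is an Ulrich module with respect to `xs`: the sequence is weakly regular on `W` and
`𝔪 W = xs W`. -/
structure IsUlrich : Prop where
  isWeaklyRegular : IsWeaklyRegular W xs
  smul_top_le : maximalIdeal S • (⊤ : Submodule S W) ≤ Ideal.ofList xs • ⊤

lemma IsUlrich.nontrivial_quotient [Module.Finite S W] [Nontrivial W] (hW : IsUlrich xs W)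
    (hmem : ∀ r ∈ xs, r ∈ maximalIdeal S) :
    Nontrivial (W ⧸ (Ideal.ofList xs • ⊤ : Submodule S W)) :=
  Submodule.Quotient.nontrivial_iff.mpr
    ((isRegular_iff_isWeaklyRegular_of_subset_maximalIdeal hmem).mpr
      hW.isWeaklyRegular).top_ne_smul.symm

lemma IsUlrich.smul_quotient_eq_zero (hW : IsUlrich xs W) {s : S} (hs : s ∈ maximalIdeal S)
    (w : W ⧸ (Ideal.ofList xs • ⊤ : Submodule S W)) : s • w = 0 := by
  obtain ⟨w, rfl⟩ := Submodule.Quotient.mk_surjective _ w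
  rw [← Submodule.Quotient.mk_smul, Submodule.Quotient.mk_eq_zero]
  exact hW.smul_top_le (Submodule.smul_mem_smul hs Submodule.mem_top)

end Ulrich

section VanishingRank

variable {R : Type u} [CommRing R] [IsLocalRing R] {M : Type u} [AddCommGroup M] [Module R M]
  (F : MinimalFreeResolution R M)

lemma MinimalFreeResolution.toMatrix'_mem_maximalIdeal (n : ℕ) (i : Fin (F.rank n))
    (j : Fin (F.rank (n + 1))) : (F.d n).toMatrix' i j ∈ maximalIdeal R := by
  have hcol := (mem_ideal_smul_top_iff_repr (Pi.basisFun R _) _ _).mp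
    (F.minimal n ⟨Pi.single j 1, rfl⟩) i
  simpa [LinearMap.toMatrix'_apply, Pi.single_apply] using hcol

variable {S : Type u} [CommRing S] [IsLocalRing S] [Algebra R S]
  (hm : (maximalIdeal R).map (algebraMap R S) = maximalIdeal S) {xs : List S}
  {N : Type u} [AddCommGroup N] [Module R N] (hN : IsUlrich xs (S ⊗[R] N))

include hm hN

lemma MinimalFreeResolution.toMatrix'_smul_quotient_eq_zero (n : ℕ) (i : Fin (F.rank n))
    (j : Fin (F.rank (n + 1)))
    (w : (S ⊗[R] N) ⧸ (Ideal.ofList xs • ⊤ : Submodule S (S ⊗[R] N))) :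
    (F.d n).toMatrix' i j • w = 0 :=
  (algebraMap_smul S _ w).symm.trans <| hN.smul_quotient_eq_zero
    (hm ▸ Ideal.mem_map_of_mem _ (F.toMatrix'_mem_maximalIdeal n i j)) w

variable [Module.FaithfullyFlat R S] [Module.Finite R N] [Nontrivial N]
  (hmem : ∀ r ∈ xs, r ∈ maximalIdeal S)

include hmem

lemma MinimalFreeResolution.rank_eq_zero_of_extVanishes (n : ℕ)
    (h : ∀ i, n + 1 ≤ i → i ≤ n + 1 + xs.length → ExtVanishes R M N i) :
    F.rank (n + 1) = 0 := by
  have := hN.nontrivial_quotient hmem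
  have hexact (j : ℕ) (hnj : n ≤ j) (hjn : j ≤ n + xs.length) :
      Function.Exact (matrixAction (F.d j).toMatrix'.transpose N)
        (matrixAction (F.d (j + 1)).toMatrix'.transpose N) :=
    exact_matrixAction_transpose (F.exact_d j).linearMap_comp_eq_zero
      fun _ ↦ F.exists_comp_d_eq_of_extVanishes (h (j + 1) (by lia) (by lia))
  have hquot := exact_matrixAction_quotient_of_cochain (ι := fun j ↦ Fin (F.rank j))
    (fun j ↦ (F.d j).toMatrix'.transpose) hN.isWeaklyRegular n
    fun j hnj hjn ↦ exact_matrixAction_tensorProduct (hexact j hnj hjn)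
  simpa using Fintype.card_eq_zero_iff.mpr (isEmpty_of_exact_matrixAction
    (fun i k ↦ F.toMatrix'_smul_quotient_eq_zero hm hN n k i)
    (fun i k ↦ F.toMatrix'_smul_quotient_eq_zero hm hN (n + 1) k i) hquot)

lemma MinimalFreeResolution.rank_eq_zero_of_torVanishes (n : ℕ)
    (h : ∀ i, n + 1 ≤ i → i ≤ n + 1 + xs.length → TorVanishes R N M i) :
    F.rank (n + xs.length + 1) = 0 := by
  have := hN.nontrivial_quotient hmem
  have hexact (j : ℕ) (hnj : n ≤ j) (hjn : j ≤ n + xs.length) :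
      Function.Exact (matrixAction (F.d (j + 1)).toMatrix' N) (matrixAction (F.d j).toMatrix' N) :=
    exact_matrixAction_of_lTensor (F.exact_lTensor_of_torVanishes (h (j + 1) (by lia) (by lia)))
  have hquot := exact_matrixAction_quotient_of_chain (fun j ↦ (F.d j).toMatrix')
    hN.isWeaklyRegular rfl fun j hnj hjn ↦ exact_matrixAction_tensorProduct (hexact j hnj hjn)
  simpa using Fintype.card_eq_zero_iff.mpr (isEmpty_of_exact_matrixAction
    (F.toMatrix'_smul_quotient_eq_zero hm hN _) (F.toMatrix'_smul_quotient_eq_zero hm hN _) hquot)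

end VanishingRank

section FiniteResolution

namespace MinimalFreeResolution

variable {R : Type u} [CommRing R] [IsLocalRing R] {M : Type u} [AddCommGroup M] [Module R M]

/-- The minimal free resolution of the first syzygy of `M` obtained by dropping the term of
degree zero. -/
def tail (F : MinimalFreeResolution R M) : MinimalFreeResolution R (LinearMap.range (F.d 0)) where
  rank n := F.rank (n + 1)
  d n := F.d (n + 1)
  ε := (F.d 0).rangeRestrict
  surjective_ε := (F.d 0).surjective_rangeRestrict
  exact_ε := LinearMap.exact_iff.mpr <| by
    rw [LinearMap.ker_rangeRestrict, (F.exact_d 0).linearMap_ker_eq]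
  exact_d n := F.exact_d (n + 1)
  minimal n := F.minimal (n + 1)

lemma free_of_subsingleton_range (F : MinimalFreeResolution R M)
    [Subsingleton (LinearMap.range (F.d 0))] : Module.Free R M := by
  have hker : LinearMap.ker F.ε = ⊥ :=
    F.exact_ε.linearMap_ker_eq.trans (Submodule.subsingleton_iff_eq_bot.mp inferInstance)
  exact .of_equiv (.ofBijective F.ε ⟨LinearMap.ker_eq_bot.mp hker, F.surjective_ε⟩)

variable {S : Type u} [CommRing S] [Algebra R S]

lemma surjective_baseChange_ε (F : MinimalFreeResolution R M) :
    Function.Surjective (F.ε.baseChange S) :=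
  LinearMap.lTensor_surjective S F.surjective_ε

lemma range_baseChange_subtype_le [IsLocalRing S] (F : MinimalFreeResolution R M)
    (hm : (maximalIdeal R).map (algebraMap R S) = maximalIdeal S) :
    LinearMap.range ((LinearMap.range (F.d 0)).subtype.baseChange S) ≤ maximalIdeal S • ⊤ :=
  hm ▸ range_baseChange_le (by simpa using F.minimal 0)

variable [Module.Flat R S]

lemma injective_baseChange_subtype (F : MinimalFreeResolution R M) :
    Function.Injective ((LinearMap.range (F.d 0)).subtype.baseChange S) :=
  Module.Flat.lTensor_preserves_injective_linearMap _ (Submodule.subtype_injective _)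

lemma exact_baseChange_subtype_ε (F : MinimalFreeResolution R M) :
    Function.Exact ((LinearMap.range (F.d 0)).subtype.baseChange S) (F.ε.baseChange S) :=
  Module.Flat.lTensor_exact S <| LinearMap.exact_iff.mpr <| by
    rw [Submodule.range_subtype, F.exact_ε.linearMap_ker_eq]

end MinimalFreeResolution

variable {R : Type u} [CommRing R] [IsLocalRing R] {M : Type u} [AddCommGroup M] [Module R M]
  {S : Type u} [CommRing S] [IsLocalRing S] [Algebra R S] [Module.FaithfullyFlat R S]
  (hm : (maximalIdeal R).map (algebraMap R S) = maximalIdeal S) {xs : List S}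

include hm

lemma MinimalFreeResolution.maximalIdeal_le_or_free (F : MinimalFreeResolution R M)
    (hxs : IsWeaklyRegular S xs) (hsq : maximalIdeal S ^ 2 ≤ Ideal.ofList xs)
    (hM : IsWeaklyRegular (S ⊗[R] M) xs) {j : ℕ} (hj : F.rank j = 0) :
    maximalIdeal S ≤ Ideal.ofList xs ∨ Module.Free R M := by
  induction j generalizing M with
  | zero =>
    have : IsEmpty (Fin (F.rank 0)) := by rw [hj]; infer_instance
    have := F.surjective_ε.subsingleton
    exact .inr (.of_subsingleton R M)
  | succ j ih =>
    have hsyz : IsWeaklyRegular (S ⊗[R] LinearMap.range (F.d 0)) xs :=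
      isWeaklyRegular_of_exact F.injective_baseChange_subtype F.surjective_baseChange_ε
        F.exact_baseChange_subtype_ε (isWeaklyRegular_of_flat hxs) hM
    obtain hle | hfree := ih F.tail hsyz hj
    · exact .inl hle
    obtain hsub | hnon := subsingleton_or_nontrivial (LinearMap.range (F.d 0))
    · exact .inr F.free_of_subsingleton_range
    · have : Nontrivial (S ⊗[R] LinearMap.range (F.d 0)) :=
        Module.FaithfullyFlat.lTensor_nontrivial R S _
      exact .inl (maximalIdeal_le_of_injective F.injective_baseChange_subtype
        F.surjective_baseChange_ε F.exact_baseChange_subtype_ε hM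
        (F.range_baseChange_subtype_le hm) hsq)

lemma MinimalFreeResolution.maximalIdeal_le_of_rank_eq_zero [Nontrivial M]
    (F : MinimalFreeResolution R M) (hxs : IsWeaklyRegular S xs)
    (hsq : maximalIdeal S ^ 2 ≤ Ideal.ofList xs) (hM : IsUlrich xs (S ⊗[R] M)) {j : ℕ}
    (hj : F.rank j = 0) : maximalIdeal S ≤ Ideal.ofList xs := by
  obtain hle | hfree := F.maximalIdeal_le_or_free hm hxs hsq hM.isWeaklyRegular hj
  · exact hle
  · have : Nontrivial (S ⊗[R] M) := Module.FaithfullyFlat.lTensor_nontrivial R S _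
    exact le_of_smul_top_le hM.smul_top_le

variable [IsNoetherianRing R] [Module.Finite R M]

lemma free_of_maximalIdeal_le (hmem : ∀ r ∈ xs, r ∈ maximalIdeal S)
    (hM : IsWeaklyRegular (S ⊗[R] M) xs) (hle : maximalIdeal S ≤ Ideal.ofList xs) :
    Module.Free R M := by
  obtain ⟨F⟩ := nonempty_minimalFreeResolution (R := R) M
  have : Subsingleton (S ⊗[R] LinearMap.range (F.d 0)) :=
    subsingleton_of_range_le F.injective_baseChange_subtype F.surjective_baseChange_ε
      F.exact_baseChange_subtype_ε hmem hM
      ((F.range_baseChange_subtype_le hm).trans (Submodule.smul_mono_left hle))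
  have := (Module.FaithfullyFlat.subsingleton_tensorProduct_iff_right R S).mp this
  exact F.free_of_subsingleton_range

variable [IsNoetherianRing S] {N : Type u} [AddCommGroup N] [Module R N] [Module.Finite R N]
  [Nontrivial M] [Nontrivial N] (hxs : IsMinimalReduction xs) (hM : IsUlrich xs (S ⊗[R] M))
  (hN : IsUlrich xs (S ⊗[R] N))

include hxs hM hN

lemma maximalIdeal_le_of_extVanishes
    (h : ∃ n, 1 ≤ n ∧ ∀ i, n ≤ i → i ≤ n + xs.length → ExtVanishes R M N i) :
    maximalIdeal S ≤ Ideal.ofList xs := by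
  obtain ⟨n, hn, h⟩ := h
  obtain ⟨n, rfl⟩ := Nat.exists_eq_add_of_le' hn
  obtain ⟨F⟩ := nonempty_minimalFreeResolution (R := R) M
  exact F.maximalIdeal_le_of_rank_eq_zero hm hxs.isWeaklyRegular hxs.sq_le hM
    (F.rank_eq_zero_of_extVanishes hm hN hxs.mem_maximalIdeal n h)

lemma maximalIdeal_le_of_torVanishes
    (h : ∃ n, 1 ≤ n ∧ ∀ i, n ≤ i → i ≤ n + xs.length → TorVanishes R M N i) :
    maximalIdeal S ≤ Ideal.ofList xs := by
  obtain ⟨n, hn, h⟩ := h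
  obtain ⟨n, rfl⟩ := Nat.exists_eq_add_of_le' hn
  obtain ⟨F⟩ := nonempty_minimalFreeResolution (R := R) N
  exact F.maximalIdeal_le_of_rank_eq_zero hm hxs.isWeaklyRegular hxs.sq_le hN
    (F.rank_eq_zero_of_torVanishes hm hM hxs.mem_maximalIdeal n h)

end FiniteResolution

lemma exists_isUlrich_genericExtension {R : Type u} [CommRing R]
    [IsLocalRing R] [IsNoetherianRing R] {d : ℕ} (hd : ringKrullDim R = d)
    (hCM : IsCohenMacaulay R) (hmin : HasMinimalMultiplicity R) {M N : Type u} [AddCommGroup M]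
    [Module R M] [AddCommGroup N] [Module R N] [Nontrivial M] [Nontrivial N]
    (hM : IsMaximalCohenMacaulay R M) (hN : IsMaximalCohenMacaulay R N)
    (hMs : IsImageOfSyzygies R M) (hNs : IsImageOfSyzygies R N) :
    ∃ xs : List (GenericExtension R), xs.length = d ∧ IsMinimalReduction xs ∧
      IsUlrich xs (GenericExtension R ⊗[R] M) ∧ IsUlrich xs (GenericExtension R ⊗[R] N) ∧
      (IsRegularLocalRing R ↔ maximalIdeal (GenericExtension R) ≤ Ideal.ofList xs) := by
  have hm := map_maximalIdeal_genericExtension R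
  have hdim := ringKrullDim_genericExtension R
  have := hM.finite
  have := hN.finite
  have hdepth {L : Type u} [AddCommGroup L] [Module R L] [Nontrivial L]
      (h : (depth R L : WithBot ℕ∞) = ringKrullDim R) :
      HasDepth (GenericExtension R) d (GenericExtension R ⊗[R] L) :=
    (hasDepth_of_depth_eq (WithBot.coe_injective (h.trans hd))).tensorProduct
  obtain ⟨xs, hlen, hxs, hxsM, hxsN⟩ :=
    (hmin.of_flat hm hdim).exists_isMinimalReduction (hdim.trans hd)
      ((hdepth hCM).congr (AlgebraTensorModule.rid R _ _)) (hdepth hM.depth_eq)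
      (hdepth hN.depth_eq)
  exact ⟨xs, hlen, hxs, ⟨hxsM, hMs.maximalIdeal_smul_tensorProduct_le hm hxs⟩,
    ⟨hxsN, hNs.maximalIdeal_smul_tensorProduct_le hm hxs⟩,
    (isRegularLocalRing_iff_of_flat hm hdim).symm.trans
      (hxs.isRegularLocalRing_iff (hlen ▸ hdim.trans hd))⟩

end MinMult

end

theorem theorem4p1 (R : Type u) [CommRing R] [IsLocalRing R] [IsNoetherianRing R]
    (d : ℕ) (hd : ringKrullDim R = d)
    (hCM : MinMult.IsCohenMacaulay R) (hmin : MinMult.HasMinimalMultiplicity R)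
    (M N : Type u) [AddCommGroup M] [Module R M] [AddCommGroup N] [Module R N]
    [Nontrivial M] [Nontrivial N]
    (hM : MinMult.IsMaximalCohenMacaulay R M) (hN : MinMult.IsMaximalCohenMacaulay R N)
    (hMs : MinMult.IsImageOfSyzygies R M) (hNs : MinMult.IsImageOfSyzygies R N) :
    List.TFAE [
      ∃ n : ℕ, 1 ≤ n ∧ ∀ i : ℕ, n ≤ i → i ≤ n + d → MinMult.ExtVanishes R M N i,
      ∀ i : ℕ, 1 ≤ i → MinMult.ExtVanishes R M N i,
      IsRegularLocalRing R,
      ∃ n : ℕ, 1 ≤ n ∧ ∀ i : ℕ, n ≤ i → i ≤ n + d → MinMult.TorVanishes R M N i,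
      ∀ i : ℕ, 1 ≤ i → MinMult.TorVanishes R M N i] := by
  have := hM.finite
  have := hN.finite
  obtain ⟨xs, rfl, hxs, hMxs, hNxs, hregular⟩ :=
    MinMult.exists_isUlrich_genericExtension hd hCM hmin hM hN hMs hNs
  have hm := MinMult.map_maximalIdeal_genericExtension R
  have hfree {L : Type u} [AddCommGroup L] [Module R L] [Module.Finite R L]
      (hL : MinMult.IsUlrich xs (TensorProduct R (MinMult.GenericExtension R) L))
      (h : IsRegularLocalRing R) : Module.Free R L :=
    MinMult.free_of_maximalIdeal_le hm hxs.mem_maximalIdeal hL.isWeaklyRegular (hregular.mp h)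
  tfae_have 2 → 1 := fun h ↦ ⟨1, le_rfl, fun i hi _ ↦ h i hi⟩
  tfae_have 5 → 4 := fun h ↦ ⟨1, le_rfl, fun i hi _ ↦ h i hi⟩
  tfae_have 1 → 3 := fun h ↦
    hregular.mpr (MinMult.maximalIdeal_le_of_extVanishes hm hxs hMxs hNxs h)
  tfae_have 4 → 3 := fun h ↦
    hregular.mpr (MinMult.maximalIdeal_le_of_torVanishes hm hxs hMxs hNxs h)
  tfae_have 3 → 2 := fun h i hi ↦ by
    have := hfree hMxs h
    obtain ⟨i, rfl⟩ := Nat.exists_eq_add_of_le' hi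
    exact MinMult.extVanishes_of_free M N i
  tfae_have 3 → 5 := fun h i hi ↦ by
    have := hfree hNxs h
    obtain ⟨i, rfl⟩ := Nat.exists_eq_add_of_le' hi
    exact MinMult.torVanishes_of_free M N i
  tfae_finish
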